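/- Let $\mu\in\mathbb{R}\setminus\{0\}$ and $0<T<\infty$. For $d\ge 1$ and an integer $k\ge 0$ set $\|f\|_{\Sigma^k}:=\|f\|_{H^k(\mathbb{R}^d)}+\||x|^k f\|_{L^2(\mathbb{R}^d)}$ for $f\in L^2(\mathbb{R}^d)$ (possibly $+\infty$), where $\|f\|_{H^k}=\|(1+|\eta|^2)^{k/2}\hat f(\eta)\|_{L^2}$, with the unitary Fourier transform in the angular frequency $\eta$. Let $\psi:[0,T]\to L^2(\mathbb{R}^d)$ be a solution of the cubic nonlinear Schrödinger equation $$ i\partial_t\psi=-\Delta\psi+\mu|\psi|^2\psi,\qquad \psi(0)=\psi_0, $$ that is, at every $t\in[0,T]$ the derivative $\partial_t\psi$ exists in $L^2(\mathbb{R}^d)$ (one-sided at the end points), the distribution $\Delta\psi(t)$ and $|\psi(t)|^2\psi(t)$ lie in $L^2(\mathbb{R}^d)$, and the equation holds in $L^2(\mathbb{R}^d)$. Put $M_k:=\sup_{t\in[0,T]}\|\psi(t)\|_{\Sigma^k}$. For a time step $\tau>0$ let $\psi^n$ be the Lie splitting approximations $$ \psi^0=\psi_0,\qquad \psi^{n+1}=e^{i\tau\Delta}e^{-i\tau\mu|\psi^n|^2}\psi^n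 . $$ Let $k_0>d/2+2$ and $k_1>\max\{d/2+2,3\}$ be integers. (a) If $M_{k_0}<\infty$, then for all $\tau>0$ and all integers $n\ge 0$ with $t_n=n\tau\le T$, $$\|\psi^n-\psi(t_n)\|_{L^2}\le C_{k_0}\,\tau .$$ (b) If $M_{k_1}<\infty$, then for all $\tau>0$ and all integers $n\ge 0$ with $t_n=n\tau\le T$, $$\|\psi^n-\psi(t_n)\|_{H^1}\le C_{k_1}\,\tau .$$ Here $C_k>0$ ($k\in\{k_0,k_1\}$) depends, for the fixed coefficient $\mu$, only on $k$, $T$ and $M_k$; more precisely, for every finite $M\geq 0$ one constant $C_k$ serves for all solutions with $M_k\le M$. -/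

import Mathlib

open MeasureTheory
open scoped FourierTransform SchwartzMap ENNReal NNReal Laplacian

noncomputable section

namespace LieNLS

/-- The space `L²(ℝ^d; ℂ)` with respect to Lebesgue measure. -/
abbrev L2 (d : ℕ) : Type :=
  Lp ℂ 2 (volume : Measure (EuclideanSpace ℝ (Fin d)))

/-- The Sobolev norm `‖f‖_{H^k} = ‖(1 + |η|²)^{k/2} f̂‖_{L²}` of `f ∈ L²(ℝ^d)`, with value `∞` if
`f ∉ H^k`. Mathlib's Fourier transform has the kernel `e^{-2πi⟨x,ξ⟩}`, so that the angular
frequency is `η = 2πξ`; for `k = 1` this is `(‖f‖²_{L²} + ‖∇f‖²_{L²})^{1/2}`. -/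
def sobolevNorm {d : ℕ} (k : ℕ) (f : L2 d) : ℝ≥0∞ :=
  eLpNorm (fun ξ : EuclideanSpace ℝ (Fin d) =>
    (((1 + (2 * Real.pi * ‖ξ‖) ^ 2) ^ ((k : ℝ) / 2) : ℝ) : ℂ) * (𝓕 f : L2 d) ξ) 2 volume

/-- The norm `‖f‖_{Σ^k} = ‖f‖_{H^k} + ‖|x|^k f‖_{L²}` of `f ∈ L²(ℝ^d)`; the space `Σ^k` consists of
the `f ∈ L²(ℝ^d)` for which it is finite. -/
def sigmaNorm {d : ℕ} (k : ℕ) (f : L2 d) : ℝ≥0∞ :=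
  sobolevNorm k f +
    eLpNorm (fun x : EuclideanSpace ℝ (Fin d) => ((‖x‖ ^ k : ℝ) : ℂ) * f x) 2 volume

theorem memLp_phase_mul {d : ℕ} {θ : EuclideanSpace ℝ (Fin d) → ℝ}
    (hθ : AEStronglyMeasurable θ volume) (f : L2 d) :
    MemLp (fun x => Complex.exp (Complex.I * (θ x : ℂ)) * f x) 2 volume := by
  refine (Lp.memLp f).of_le ?_ (Filter.Eventually.of_forall fun x => ?_)
  · exact (Complex.continuous_exp.comp_aestronglyMeasurable
      ((Complex.continuous_ofReal.comp_aestronglyMeasurable hθ).const_mul Complex.I)).mul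
        (Lp.aestronglyMeasurable f)
  · rw [norm_mul, mul_comm Complex.I, Complex.norm_exp_ofReal_mul_I, one_mul]

/-- Multiplication of `f ∈ L²(ℝ^d)` by the phase factor `e^{iθ(x)}`. -/
def phaseMul {d : ℕ} (θ : EuclideanSpace ℝ (Fin d) → ℝ)
    (hθ : AEStronglyMeasurable θ volume) (f : L2 d) : L2 d :=
  (memLp_phase_mul hθ f).toLp _

theorem aestronglyMeasurable_symbol (d : ℕ) (t : ℝ) :
    AEStronglyMeasurable
      (fun ξ : EuclideanSpace ℝ (Fin d) => -(t * (2 * Real.pi * ‖ξ‖) ^ 2)) volume :=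
  Continuous.aestronglyMeasurable (by fun_prop)

/-- The free Schrödinger propagator `e^{itΔ}` on `L²(ℝ^d)`: the Fourier multiplier with symbol
`e^{-it|η|²}`, `η = 2πξ`. -/
def freeFlow {d : ℕ} (t : ℝ) (f : L2 d) : L2 d :=
  𝓕⁻ (phaseMul _ (aestronglyMeasurable_symbol d t) (𝓕 f : L2 d))

theorem aestronglyMeasurable_cubic_phase {d : ℕ} (c : ℝ) (f : L2 d) :
    AEStronglyMeasurable (fun x => -(c * ‖f x‖ ^ 2)) volume :=
  ((Lp.aestronglyMeasurable f).norm.pow 2 |>.const_mul c).neg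

/-- The flow `f ↦ e^{-iτμ|f|²} f` of the nonlinear part. -/
def nonlinearFlow {d : ℕ} (μ τ : ℝ) (f : L2 d) : L2 d :=
  phaseMul _ (aestronglyMeasurable_cubic_phase (τ * μ) f) f

/-- The Lie splitting iterates `ψ^{n+1} = e^{iτΔ} e^{-iτμ|ψ^n|²} ψ^n`, `ψ^0 = ψ₀`. -/
def lieSplitting {d : ℕ} (μ τ : ℝ) (ψ₀ : L2 d) : ℕ → L2 d
  | 0 => ψ₀
  | n + 1 => freeFlow τ (nonlinearFlow μ τ (lieSplitting μ τ ψ₀ n))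

/-- `ψ` is a solution on `[0,T]` of `i ∂ₜψ = -Δψ + μ|ψ|²ψ`, `ψ(0) = ψ₀`, as an equation in
`L²(ℝ^d)`: at every `t ∈ [0,T]` the time derivative exists in `L²` (one-sided at the end points),
the distributional Laplacian `Δψ(t)` and `|ψ(t)|²ψ(t)` belong to `L²`, and the equation holds. -/
structure IsSolution {d : ℕ} (μ T : ℝ) (ψ₀ : L2 d) (ψ : ℝ → L2 d) : Prop where
  initial : ψ 0 = ψ₀
  equation : ∀ t ∈ Set.Icc 0 T, ∃ dtψ lap cub : L2 d,
    HasDerivWithinAt ψ dtψ (Set.Icc 0 T) t ∧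
    (lap : 𝓢'(EuclideanSpace ℝ (Fin d), ℂ)) = Δ (ψ t : 𝓢'(EuclideanSpace ℝ (Fin d), ℂ)) ∧
    cub =ᵐ[volume] (fun x => ((‖ψ t x‖ ^ 2 : ℝ) : ℂ) * ψ t x) ∧
    Complex.I • dtψ = -lap + (μ : ℂ) • cub

/-- `M_k = sup_{t ∈ [0,T]} ‖ψ(t)‖_{Σ^k}`. -/
def supSigmaNorm {d : ℕ} (k : ℕ) (T : ℝ) (ψ : ℝ → L2 d) : ℝ≥0∞ :=
  ⨆ t ∈ Set.Icc 0 T, sigmaNorm k (ψ t)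

end LieNLS

end

/-!
The weights `|x|^k` play no role: the error is controlled by Sobolev norms alone. Put `s = k - 2`.
The hypothesis `k > d/2 + 2` says `s > d/2`, so that `H^s` is a Banach algebra of continuous
functions (`isFunctionAlgebra_sobolevFun`), and the scheme converges with order one in `H^s` for
every solution bounded in `H^{s+2}` (`exists_sobolevNorm_error_le`). As `s ≥ 0`, and `s ≥ 1` if
`k > 3`, this contains the estimates in `L²` and in `H^1`. For given `k` there are finitely many
dimensions `d < 2(k - 2)`, hence one constant serves for all of them.

Algebra property. `H^s` is parametrised by `L²` through the weighted Fourier transform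
`a = (1 + |η|²)^{s/2} f̂`. Since `s > d/2`, `f̂` is integrable by the Cauchy-Schwarz inequality, a
product of functions corresponds to a convolution of their Fourier transforms, and the weight at
`ξ` is bounded by a multiple of the sum of the weights at `η` and `ξ - η`; Young's inequality
concludes.

Nonlinear flow. Multiplication by `-iθ|a|²` is a bounded operator on `H^s`, and
`e^{-iθ|a|²} a` is its operator exponential applied to `a`. The exponential series gives the
Lipschitz bound with constant `1 + O(θ)` on bounded sets (`IsFunctionAlgebra.norm_phaseRot_sub_le`)
and the Taylor expansion up to `O(θ²)` (`IsFunctionAlgebra.norm_phaseRot_sub_taylor_le`).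

Local error. In the interaction picture, `v(t) = e^{-i(t-a)Δ}ψ(t)` satisfies
`∂ₜv = -iμ e^{-i(t-a)Δ}(|ψ|²ψ)(t)`. The right-hand side differs from its value at `t = a` by
`O(t - a)` in `H^s`, because `ψ` is Lipschitz continuous in time with values in `H^s` and because
`e^{itΔ} - 1 = O(t)` from `H^{s+2}` to `H^s`. Hence
`e^{-iτΔ}ψ(a + τ) = ψ(a) - iτμ|ψ(a)|²ψ(a) + O(τ²)`, which agrees with the expansion of the nonlinear
flow (`exists_local_error_le`). Time derivatives exist in `L²` only; the mean value inequality is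
therefore applied after a cut-off in frequency, which makes `e^{-itΔ}` differentiable in operator
norm and the `H^s` norm continuous on `L²`, and the cut-off is then removed
(`sobolevNorm_interaction_le`).

Convergence. For small `τ` the stability bound and the local error give the estimate by induction
on the number of steps; the error stays below `1`, so that the scheme does not leave the ball on
which the stability constant is valid. For the remaining `τ` the number of steps is bounded, and so
are the iterates.
-/

noncomputable section

namespace LieNLS


/-! ### The exponential in a Banach algebra -/

section Exponential

variable {𝔸 : Type*} [NormedRing 𝔸] [NormedAlgebra ℂ 𝔸] [CompleteSpace 𝔸]

theorem hasSum_exp_tail (A : 𝔸) (m : ℕ) :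
    HasSum (fun n : ℕ => ((n + m).factorial⁻¹ : ℂ) • A ^ (n + m))
      (NormedSpace.exp A - ∑ i ∈ Finset.range m, (i.factorial⁻¹ : ℂ) • A ^ i) :=
  (hasSum_nat_add_iff' m).2 (NormedSpace.exp_series_hasSum_exp' (𝕂 := ℂ) A)

theorem norm_exp_tail_le (A : 𝔸) {m : ℕ} (hm : 0 < m) :
    ‖NormedSpace.exp A - ∑ i ∈ Finset.range m, (i.factorial⁻¹ : ℂ) • A ^ i‖ ≤
      ‖A‖ ^ m * Real.exp ‖A‖ := by
  have h2 : HasSum (fun n : ℕ => ‖A‖ ^ m * (((n.factorial : ℝ))⁻¹ • ‖A‖ ^ n))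
      (‖A‖ ^ m * Real.exp ‖A‖) := by
    rw [Real.exp_eq_exp_ℝ]
    exact (NormedSpace.exp_series_hasSum_exp' (𝕂 := ℝ) ‖A‖).mul_left _
  rw [← (hasSum_exp_tail A m).tsum_eq]
  refine tsum_of_norm_bounded h2 fun n => ?_
  rw [norm_smul, norm_inv, Complex.norm_natCast, smul_eq_mul]
  calc ((n + m).factorial : ℝ)⁻¹ * ‖A ^ (n + m)‖
      ≤ ((n.factorial : ℝ))⁻¹ * ‖A‖ ^ (n + m) := by
        gcongr
        · exact Nat.le_add_right n m
        · exact norm_pow_le' _ (by omega)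
    _ = _ := by ring

theorem norm_exp_sub_one_le_mul_exp (A : 𝔸) :
    ‖NormedSpace.exp A - 1‖ ≤ ‖A‖ * Real.exp ‖A‖ := by
  simpa using norm_exp_tail_le A one_pos

theorem norm_exp_sub_one_sub_le_sq_mul_exp (A : 𝔸) :
    ‖NormedSpace.exp A - 1 - A‖ ≤ ‖A‖ ^ 2 * Real.exp ‖A‖ := by
  have h := norm_exp_tail_le A (m := 2) (by norm_num)
  simp only [Finset.sum_range_succ, Finset.sum_range_zero, Nat.factorial, Nat.cast_one, inv_one,
    pow_zero, pow_one, one_smul, zero_add, mul_one] at h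
  rwa [sub_sub]

end Exponential

/-! ### Banach algebras of functions and the phase rotation -/

/-- The Banach space `H` is realised, through the linear map `J`, as an algebra of functions on `X`
that is closed under complex conjugation, with continuous point evaluations and with
`‖ab‖ ≤ K ‖a‖ ‖b‖`. -/
structure IsFunctionAlgebra {H X : Type*} [NormedAddCommGroup H] [NormedSpace ℂ H]
    (J : H →ₗ[ℂ] X → ℂ) (K : ℝ) : Prop where
  nonneg : 0 ≤ K
  injective : Function.Injective J
  continuous : ∀ x, Continuous fun a => J a x
  exists_mul : ∀ a b, ∃ c, J c = J a * J b ∧ ‖c‖ ≤ K * ‖a‖ * ‖b‖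
  exists_conj : ∀ a, ∃ c, J c = (fun x => starRingEnd ℂ (J a x)) ∧ ‖c‖ ≤ ‖a‖

namespace IsFunctionAlgebra

variable {H X : Type*} [NormedAddCommGroup H] [NormedSpace ℂ H] {J : H →ₗ[ℂ] X → ℂ} {K : ℝ}

/-- The element of `H` that represents the pointwise product. -/
def mul (h : IsFunctionAlgebra J K) (a b : H) : H := (h.exists_mul a b).choose

theorem map_mul (h : IsFunctionAlgebra J K) (a b : H) : J (h.mul a b) = J a * J b :=
  (h.exists_mul a b).choose_spec.1

/-- Multiplication by `a`, as a bounded operator. -/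
def mulL (h : IsFunctionAlgebra J K) (a : H) : H →L[ℂ] H :=
  LinearMap.mkContinuous
    { toFun := h.mul a
      map_add' := fun b b' => h.injective <| by simp only [map_add, map_mul, mul_add]
      map_smul' := fun c b => h.injective <| by
        simp only [map_smul, map_mul, mul_smul_comm, RingHom.id_apply] }
    (K * ‖a‖) fun b => (h.exists_mul a b).choose_spec.2

theorem map_mulL (h : IsFunctionAlgebra J K) (a b : H) : J (h.mulL a b) = J a * J b :=
  h.map_mul a b

theorem norm_mulL_le (h : IsFunctionAlgebra J K) (a : H) : ‖h.mulL a‖ ≤ K * ‖a‖ :=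
  LinearMap.mkContinuous_norm_le _ (mul_nonneg h.nonneg (norm_nonneg _)) _

theorem norm_mulL_apply_le (h : IsFunctionAlgebra J K) (a b : H) :
    ‖h.mulL a b‖ ≤ K * ‖a‖ * ‖b‖ :=
  (h.exists_mul a b).choose_spec.2

theorem mulL_sub (h : IsFunctionAlgebra J K) (a b : H) : h.mulL (a - b) = h.mulL a - h.mulL b := by
  ext c
  refine h.injective ?_
  simp only [map_mulL, map_sub, sub_apply, sub_mul]

theorem commute_mulL (h : IsFunctionAlgebra J K) (a b : H) : Commute (h.mulL a) (h.mulL b) := by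
  ext c
  refine h.injective ?_
  simp only [mul_apply_eq_comp, map_mulL, mul_left_comm]

/-- The complex conjugate of `a`. -/
def conj (h : IsFunctionAlgebra J K) (a : H) : H := (h.exists_conj a).choose

theorem map_conj (h : IsFunctionAlgebra J K) (a : H) :
    J (h.conj a) = fun x => starRingEnd ℂ (J a x) :=
  (h.exists_conj a).choose_spec.1

theorem norm_conj_le (h : IsFunctionAlgebra J K) (a : H) : ‖h.conj a‖ ≤ ‖a‖ :=
  (h.exists_conj a).choose_spec.2

theorem conj_sub (h : IsFunctionAlgebra J K) (a b : H) : h.conj (a - b) = h.conj a - h.conj b := by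
  refine h.injective ?_
  ext x
  simp [map_conj]

/-- The density `|a|²`. -/
def density (h : IsFunctionAlgebra J K) (a : H) : H := h.mulL a (h.conj a)

theorem map_density (h : IsFunctionAlgebra J K) (a : H) (x : X) :
    J (h.density a) x = ((‖J a x‖ ^ 2 : ℝ) : ℂ) := by
  rw [density, map_mulL, Pi.mul_apply, map_conj, Complex.mul_conj, Complex.normSq_eq_norm_sq]

theorem norm_density_le (h : IsFunctionAlgebra J K) {a : H} {R : ℝ} (ha : ‖a‖ ≤ R) :
    ‖h.density a‖ ≤ K * R ^ 2 := by
  have hK := h.nonneg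
  have hR : 0 ≤ R := (norm_nonneg a).trans ha
  calc ‖h.density a‖ ≤ K * ‖a‖ * ‖h.conj a‖ := h.norm_mulL_apply_le _ _
    _ ≤ K * R * R := by gcongr; exact (h.norm_conj_le a).trans ha
    _ = _ := by ring

theorem norm_density_sub_le (h : IsFunctionAlgebra J K) {a b : H} {R : ℝ} (ha : ‖a‖ ≤ R)
    (hb : ‖b‖ ≤ R) : ‖h.density a - h.density b‖ ≤ 2 * K * R * ‖a - b‖ := by
  have hK := h.nonneg
  have hR : 0 ≤ R := (norm_nonneg a).trans ha
  have e : h.density a - h.density b = h.mulL a (h.conj (a - b)) + h.mulL (a - b) (h.conj b) := by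
    simp only [density, conj_sub, mulL_sub, map_sub, sub_apply]
    abel
  calc ‖h.density a - h.density b‖
      ≤ K * ‖a‖ * ‖h.conj (a - b)‖ + K * ‖a - b‖ * ‖h.conj b‖ := by
        rw [e]
        exact (norm_add_le _ _).trans
          (add_le_add (h.norm_mulL_apply_le _ _) (h.norm_mulL_apply_le _ _))
    _ ≤ K * R * ‖a - b‖ + K * ‖a - b‖ * R := by
        gcongr
        · exact h.norm_conj_le _
        · exact (h.norm_conj_le b).trans hb
    _ = _ := by ring

/-- The cubic term `|a|²a`. -/
def cubic (h : IsFunctionAlgebra J K) (a : H) : H := h.mulL (h.density a) a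

theorem map_cubic (h : IsFunctionAlgebra J K) (a : H) (x : X) :
    J (h.cubic a) x = ((‖J a x‖ ^ 2 : ℝ) : ℂ) * J a x := by
  rw [cubic, map_mulL, Pi.mul_apply, map_density]

theorem norm_cubic_le (h : IsFunctionAlgebra J K) {a : H} {R : ℝ} (ha : ‖a‖ ≤ R) :
    ‖h.cubic a‖ ≤ K ^ 2 * R ^ 3 := by
  have hK := h.nonneg
  have hR : 0 ≤ R := (norm_nonneg a).trans ha
  calc ‖h.cubic a‖ ≤ K * ‖h.density a‖ * ‖a‖ := h.norm_mulL_apply_le _ _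
    _ ≤ K * (K * R ^ 2) * R := by gcongr; exact h.norm_density_le ha
    _ = _ := by ring

theorem norm_cubic_sub_le (h : IsFunctionAlgebra J K) {a b : H} {R : ℝ} (ha : ‖a‖ ≤ R)
    (hb : ‖b‖ ≤ R) : ‖h.cubic a - h.cubic b‖ ≤ 3 * K ^ 2 * R ^ 2 * ‖a - b‖ := by
  have hK := h.nonneg
  have hR : 0 ≤ R := (norm_nonneg a).trans ha
  have e : h.cubic a - h.cubic b =
      h.mulL (h.density a) (a - b) + h.mulL (h.density a - h.density b) b := by
    simp only [cubic, mulL_sub, map_sub, sub_apply]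
    abel
  calc ‖h.cubic a - h.cubic b‖
      ≤ K * ‖h.density a‖ * ‖a - b‖ + K * ‖h.density a - h.density b‖ * ‖b‖ := by
        rw [e]
        exact (norm_add_le _ _).trans
          (add_le_add (h.norm_mulL_apply_le _ _) (h.norm_mulL_apply_le _ _))
    _ ≤ K * (K * R ^ 2) * ‖a - b‖ + K * (2 * K * R * ‖a - b‖) * R := by
        gcongr
        · exact h.norm_density_le ha
        · exact h.norm_density_sub_le ha hb
    _ = _ := by ring

/-- The generator `-iθ|a|²` of the phase rotation, as a multiplication operator. -/
def phaseGen (h : IsFunctionAlgebra J K) (θ : ℝ) (a : H) : H →L[ℂ] H :=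
  (-(Complex.I * θ)) • h.mulL (h.density a)

theorem phaseGen_apply_self (h : IsFunctionAlgebra J K) (θ : ℝ) (a : H) :
    h.phaseGen θ a a = (-(Complex.I * θ)) • h.cubic a := rfl

theorem commute_phaseGen (h : IsFunctionAlgebra J K) (θ : ℝ) (a b : H) :
    Commute (h.phaseGen θ a) (h.phaseGen θ b) :=
  ((h.commute_mulL _ _).smul_left _).smul_right _

theorem norm_phaseGen_le (h : IsFunctionAlgebra J K) (θ : ℝ) {a : H} {R : ℝ} (ha : ‖a‖ ≤ R) :
    ‖h.phaseGen θ a‖ ≤ |θ| * (K ^ 2 * R ^ 2) := by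
  have hK := h.nonneg
  rw [phaseGen, norm_smul, norm_neg, norm_mul, Complex.norm_I, one_mul, Complex.norm_real,
    Real.norm_eq_abs]
  gcongr
  calc ‖h.mulL (h.density a)‖ ≤ K * (K * R ^ 2) :=
        (h.norm_mulL_le _).trans (by gcongr; exact h.norm_density_le ha)
    _ = _ := by ring

theorem norm_phaseGen_sub_le (h : IsFunctionAlgebra J K) (θ : ℝ) {a b : H} {R : ℝ}
    (ha : ‖a‖ ≤ R) (hb : ‖b‖ ≤ R) :
    ‖h.phaseGen θ a - h.phaseGen θ b‖ ≤ |θ| * (2 * K ^ 2 * R) * ‖a - b‖ := by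
  have hK := h.nonneg
  rw [phaseGen, phaseGen, ← smul_sub, ← mulL_sub, norm_smul, norm_neg, norm_mul, Complex.norm_I,
    one_mul, Complex.norm_real, Real.norm_eq_abs, mul_assoc |θ|]
  gcongr
  calc ‖h.mulL (h.density a - h.density b)‖ ≤ K * (2 * K * R * ‖a - b‖) :=
        (h.norm_mulL_le _).trans (by gcongr; exact h.norm_density_sub_le ha hb)
    _ = _ := by ring

variable [CompleteSpace H]

/-- The phase rotation `a ↦ e^{-iθ|a|²} a`. -/
def phaseRot (h : IsFunctionAlgebra J K) (θ : ℝ) (a : H) : H :=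
  NormedSpace.exp (h.phaseGen θ a) a

theorem map_exp_smul_mulL (h : IsFunctionAlgebra J K) (c : ℂ) (p a : H) (x : X) :
    J (NormedSpace.exp (c • h.mulL p) a) x = Complex.exp (c * J p x) * J a x := by
  have hpow : ∀ n : ℕ, ∀ b : H, J (((c • h.mulL p) ^ n) b) x = (c * J p x) ^ n * J b x := by
    intro n
    induction n with
    | zero => intro b; simp
    | succ n ih =>
      intro b
      rw [pow_succ, mul_apply_eq_comp, ih]
      simp only [smul_apply, map_smul, Pi.smul_apply, map_mulL, Pi.mul_apply,
        smul_eq_mul]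
      ring
  -- Point evaluation at `x` is continuous, hence can be applied to the exponential series.
  let ev : H →L[ℂ] ℂ := ⟨(LinearMap.proj x).comp J, h.continuous x⟩
  have h1 := ((NormedSpace.exp_series_hasSum_exp' (𝕂 := ℂ) (c • h.mulL p)).mapL
    (ContinuousLinearMap.apply ℂ H a)).mapL ev
  have h2 : HasSum (fun n : ℕ => ((n.factorial⁻¹ : ℂ) • (c * J p x) ^ n) * J a x)
      (Complex.exp (c * J p x) * J a x) := by
    rw [Complex.exp_eq_exp_ℂ]
    exact (NormedSpace.exp_series_hasSum_exp' (𝕂 := ℂ) (c * J p x)).mul_right _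
  refine h1.unique (h2.congr_fun ?_)
  intro n
  change J (((n.factorial⁻¹ : ℂ) • (c • h.mulL p) ^ n) a) x = _
  simp only [smul_apply, map_smul, Pi.smul_apply, hpow, smul_eq_mul, mul_assoc]

theorem map_phaseRot (h : IsFunctionAlgebra J K) (θ : ℝ) (a : H) (x : X) :
    J (h.phaseRot θ a) x =
      Complex.exp (Complex.I * ((-(θ * ‖J a x‖ ^ 2) : ℝ) : ℂ)) * J a x := by
  rw [phaseRot, phaseGen, map_exp_smul_mulL, map_density]
  congr 2
  push_cast
  ring

/-- The phase rotation is Lipschitz on bounded sets, with a constant `1 + O(θ)`. -/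
theorem norm_phaseRot_sub_le (h : IsFunctionAlgebra J K) {θ Θ : ℝ} (hθ : |θ| ≤ Θ) {a b : H}
    {R : ℝ} (ha : ‖a‖ ≤ R) (hb : ‖b‖ ≤ R) :
    ‖h.phaseRot θ a - h.phaseRot θ b‖ ≤
      (1 + 3 * (K ^ 2 * R ^ 2) * (1 + Θ * (K ^ 2 * R ^ 2)) *
        Real.exp (3 * (Θ * (K ^ 2 * R ^ 2))) * |θ|) * ‖a - b‖ := by
  have hK := h.nonneg
  have hR : 0 ≤ R := (norm_nonneg a).trans ha
  have hΘ : 0 ≤ Θ := (abs_nonneg θ).trans hθ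
  set A := h.phaseGen θ a with hA
  set B := h.phaseGen θ b with hB
  set q := K ^ 2 * R ^ 2 with hq
  have hq0 : 0 ≤ q := by positivity
  set α := Θ * q with hα
  have hα0 : 0 ≤ α := by positivity
  have nA : ‖A‖ ≤ |θ| * q := h.norm_phaseGen_le θ ha
  have nB : ‖B‖ ≤ |θ| * q := h.norm_phaseGen_le θ hb
  have hθα : |θ| * q ≤ α := mul_le_mul_of_nonneg_right hθ hq0
  have nAB : ‖A - B‖ ≤ |θ| * (2 * K ^ 2 * R) * ‖a - b‖ := h.norm_phaseGen_sub_le θ ha hb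
  have nAB' : ‖A - B‖ ≤ 2 * α := (norm_sub_le _ _).trans (by linarith)
  have hcomm : Commute B (A - B) :=
    (h.commute_phaseGen θ b a).sub_right (Commute.refl _)
  have hexp : NormedSpace.exp A = NormedSpace.exp B * NormedSpace.exp (A - B) := by
    let _ : NormedAlgebra ℚ (H →L[ℂ] H) := NormedAlgebra.restrictScalars ℚ ℂ _
    rw [← NormedSpace.exp_add_of_commute hcomm]
    congr 1
    abel
  have bd : ∀ (D : H →L[ℂ] H), ‖D‖ ≤ |θ| * q → ∀ v : H,
      ‖NormedSpace.exp D v - v‖ ≤ |θ| * q * Real.exp α * ‖v‖ := by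
    intro D hD v
    have : NormedSpace.exp D v - v = (NormedSpace.exp D - 1) v := by simp
    rw [this]
    refine (ContinuousLinearMap.le_opNorm _ _).trans ?_
    gcongr
    refine (norm_exp_sub_one_le_mul_exp D).trans ?_
    gcongr
    exact hD.trans hθα
  have bd' : ∀ (D : H →L[ℂ] H), ‖D‖ ≤ |θ| * q → ∀ v : H,
      ‖NormedSpace.exp D v‖ ≤ (1 + |θ| * q * Real.exp α) * ‖v‖ := by
    intro D hD v
    have : NormedSpace.exp D v = v + (NormedSpace.exp D v - v) := by abel
    rw [this]
    refine (norm_add_le _ _).trans ?_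
    rw [add_mul, one_mul]
    gcongr
    exact bd D hD v
  have e1 : h.phaseRot θ a - h.phaseRot θ b =
      NormedSpace.exp A (a - b) + NormedSpace.exp B ((NormedSpace.exp (A - B) - 1) b) := by
    have : NormedSpace.exp A b = NormedSpace.exp B (NormedSpace.exp (A - B) b) := by
      rw [hexp]; rfl
    simp only [phaseRot, ← hA, ← hB, map_sub, sub_apply,
      one_apply_eq_self, ← this]
    abel
  have e2 : ‖(NormedSpace.exp (A - B) - 1) b‖ ≤ |θ| * (2 * q) * Real.exp (2 * α) * ‖a - b‖ := by
    calc ‖(NormedSpace.exp (A - B) - 1) b‖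
        ≤ ‖A - B‖ * Real.exp ‖A - B‖ * ‖b‖ :=
          (ContinuousLinearMap.le_opNorm _ _).trans
            (by gcongr; exact norm_exp_sub_one_le_mul_exp _)
      _ ≤ (|θ| * (2 * K ^ 2 * R) * ‖a - b‖) * Real.exp (2 * α) * R := by gcongr
      _ = _ := by rw [hq]; ring
  have E1 : Real.exp α ≤ Real.exp (3 * α) := by gcongr; linarith
  have E2 : Real.exp (2 * α) ≤ Real.exp (3 * α) := by gcongr; linarith
  have E3 : Real.exp α * Real.exp (2 * α) = Real.exp (3 * α) := by
    rw [← Real.exp_add]; congr 1; ring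
  calc ‖h.phaseRot θ a - h.phaseRot θ b‖
      ≤ (1 + |θ| * q * Real.exp α) * ‖a - b‖ +
          (1 + |θ| * q * Real.exp α) * (|θ| * (2 * q) * Real.exp (2 * α) * ‖a - b‖) := by
        rw [e1]
        refine (norm_add_le _ _).trans (add_le_add (bd' A nA _) ((bd' B nB _).trans ?_))
        gcongr
    _ ≤ (1 + |θ| * q * Real.exp (3 * α)) * ‖a - b‖ +
          (|θ| * (2 * q) * Real.exp (3 * α) * ‖a - b‖ +
            α * (|θ| * (2 * q) * Real.exp (3 * α) * ‖a - b‖)) := by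
        have : (1 + |θ| * q * Real.exp α) * (|θ| * (2 * q) * Real.exp (2 * α) * ‖a - b‖) =
            |θ| * (2 * q) * Real.exp (2 * α) * ‖a - b‖ +
              (|θ| * q) * (|θ| * (2 * q) * (Real.exp α * Real.exp (2 * α)) * ‖a - b‖) := by ring
        rw [this, E3]
        gcongr
    _ ≤ _ := by
        have : 0 ≤ α * (|θ| * q * Real.exp (3 * α) * ‖a - b‖) := by positivity
        nlinarith [this]

/-- First-order Taylor expansion of the phase rotation in `θ`. -/
theorem norm_phaseRot_sub_taylor_le (h : IsFunctionAlgebra J K) {θ Θ : ℝ} (hθ : |θ| ≤ Θ) {a : H}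
    {R : ℝ} (ha : ‖a‖ ≤ R) :
    ‖h.phaseRot θ a - a + (Complex.I * θ) • h.cubic a‖ ≤
      (K ^ 2 * R ^ 2) ^ 2 * Real.exp (Θ * (K ^ 2 * R ^ 2)) * R * θ ^ 2 := by
  have hK := h.nonneg
  have hR : 0 ≤ R := (norm_nonneg a).trans ha
  have nA := h.norm_phaseGen_le θ ha
  have e : h.phaseRot θ a - a + (Complex.I * θ) • h.cubic a =
      (NormedSpace.exp (h.phaseGen θ a) - 1 - h.phaseGen θ a) a := by
    simp only [sub_apply, phaseGen_apply_self, phaseRot,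
      one_apply_eq_self, neg_smul, sub_neg_eq_add]
  rw [e]
  calc _ ≤ ‖h.phaseGen θ a‖ ^ 2 * Real.exp ‖h.phaseGen θ a‖ * ‖a‖ :=
        (ContinuousLinearMap.le_opNorm _ _).trans
          (by gcongr; exact norm_exp_sub_one_sub_le_sq_mul_exp _)
    _ ≤ (|θ| * (K ^ 2 * R ^ 2)) ^ 2 * Real.exp (Θ * (K ^ 2 * R ^ 2)) * R := by
        gcongr
        exact nA.trans (by gcongr)
    _ = _ := by rw [mul_pow, sq_abs]; ring

end IsFunctionAlgebra


/-! ### Young's inequality and the Fourier transform on `L¹ ∩ L²` -/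

section Fourier

variable {d : ℕ}

theorem eLpNorm_two_sq {α ε : Type*} [MeasurableSpace α] [TopologicalSpace ε]
    [ContinuousENorm ε] (f : α → ε) (μ : Measure α) :
    eLpNorm f 2 μ ^ 2 = ∫⁻ x, ‖f x‖ₑ ^ 2 ∂μ := by
  have h := eLpNorm_nnreal_pow_eq_lintegral (μ := μ) (f := f) (p := 2) two_ne_zero
  simpa using h

/-- Young's inequality `‖u ⋆ v‖₂ ≤ ‖u‖₁ ‖v‖₂`, squared. -/
theorem lintegral_conv_sq_le {u v : EuclideanSpace ℝ (Fin d) → ℝ≥0∞} (hu : Measurable u)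
    (hv : Measurable v) :
    ∫⁻ x, (∫⁻ y, u y * v (x - y)) ^ 2 ≤ (∫⁻ y, u y) ^ 2 * ∫⁻ y, v y ^ 2 := by
  have cs : ∀ x, (∫⁻ y, u y * v (x - y)) ^ 2 ≤ (∫⁻ y, u y) * ∫⁻ y, u y * v (x - y) ^ 2 := by
    intro x
    have h := ENNReal.lintegral_mul_norm_pow_le (μ := volume) (f := u)
      (g := fun y => u y * v (x - y) ^ 2) hu.aemeasurable
      (by fun_prop) (p := 1 / 2) (q := 1 / 2) (by norm_num) (by norm_num) (by norm_num)
    have e : ∀ y, u y ^ (1 / 2 : ℝ) * (u y * v (x - y) ^ 2) ^ (1 / 2 : ℝ) = u y * v (x - y) := by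
      intro y
      rw [ENNReal.mul_rpow_of_nonneg _ _ (by norm_num), ← mul_assoc,
        ← ENNReal.rpow_add_of_nonneg _ _ (by norm_num) (by norm_num), ← ENNReal.rpow_natCast,
        ← ENNReal.rpow_mul]
      norm_num
    simp only [e] at h
    calc (∫⁻ y, u y * v (x - y)) ^ 2
        ≤ ((∫⁻ y, u y) ^ (1 / 2 : ℝ) * (∫⁻ y, u y * v (x - y) ^ 2) ^ (1 / 2 : ℝ)) ^ 2 := by
          gcongr
      _ = _ := by
          rw [mul_pow, ← ENNReal.rpow_natCast, ← ENNReal.rpow_mul, ← ENNReal.rpow_natCast,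
            ← ENNReal.rpow_mul]
          norm_num
  calc ∫⁻ x, (∫⁻ y, u y * v (x - y)) ^ 2
      ≤ ∫⁻ x, (∫⁻ y, u y) * ∫⁻ y, u y * v (x - y) ^ 2 := lintegral_mono cs
    _ = (∫⁻ y, u y) * ∫⁻ x, ∫⁻ y, u y * v (x - y) ^ 2 :=
        lintegral_const_mul _ (Measurable.lintegral_prod_right' (f := fun p :
          EuclideanSpace ℝ (Fin d) × EuclideanSpace ℝ (Fin d) => u p.2 * v (p.1 - p.2) ^ 2)
          (by fun_prop))
    _ = (∫⁻ y, u y) * ∫⁻ y, ∫⁻ x, u y * v (x - y) ^ 2 := by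
        rw [lintegral_lintegral_swap]
        exact (by fun_prop : Measurable fun p :
          EuclideanSpace ℝ (Fin d) × EuclideanSpace ℝ (Fin d) =>
            u p.2 * v (p.1 - p.2) ^ 2).aemeasurable
    _ = (∫⁻ y, u y) * ∫⁻ y, u y * ∫⁻ x, v x ^ 2 := by
        congr 1
        refine lintegral_congr fun y => ?_
        rw [lintegral_const_mul _ (by fun_prop),
          lintegral_sub_right_eq_self (fun x => v x ^ 2) y]
    _ = _ := by rw [lintegral_mul_const _ hu, sq, mul_assoc]

theorem continuous_fourierInv_of_integrable {F : EuclideanSpace ℝ (Fin d) → ℂ}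
    (hF : Integrable F) : Continuous (𝓕⁻ F) := by
  rw [← Real.Lp.fourierTransformInv_toLp (memLp_one_iff_integrable.2 hF)]
  exact BoundedContinuousFunction.continuous _

/-- On `L¹ ∩ L²` the inverse Fourier transform of `L²` is given by the Fourier integral. -/
theorem fourierInv_toLp_ae_eq {F : EuclideanSpace ℝ (Fin d) → ℂ} (h1 : Integrable F)
    (h2 : MemLp F 2 volume) : (𝓕⁻ (h2.toLp F) : L2 d) =ᵐ[volume] 𝓕⁻ F := by
  refine ae_eq_of_integral_contDiff_smul_eq ?_ ?_ fun g hg hgc => ?_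
  · exact (Lp.memLp _).locallyIntegrable (by norm_num)
  · exact (continuous_fourierInv_of_integrable h1).locallyIntegrable
  have hg₁ : HasCompactSupport (Complex.ofRealCLM ∘ g) := hgc.comp_left rfl
  have hg₂ : ContDiff ℝ (⊤ : ℕ∞) (Complex.ofRealCLM ∘ g) := by fun_prop
  let φ : 𝓢(EuclideanSpace ℝ (Fin d), ℂ) := hg₁.toSchwartzMap hg₂
  have hφ : ∀ x, φ x = (g x : ℂ) := fun x => rfl
  calc ∫ x, g x • (𝓕⁻ (h2.toLp F) : L2 d) x
      = ((𝓕⁻ (h2.toLp F) : L2 d) : 𝓢'(EuclideanSpace ℝ (Fin d), ℂ)) φ := by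
        rw [Lp.toTemperedDistribution_apply]
        simp [hφ]
    _ = ((h2.toLp F : L2 d) : 𝓢'(EuclideanSpace ℝ (Fin d), ℂ)) (𝓕⁻ φ) := by
        rw [← Lp.fourierInv_toTemperedDistribution_eq, TemperedDistribution.fourierInv_apply]
    _ = ∫ x, 𝓕⁻ (φ : EuclideanSpace ℝ (Fin d) → ℂ) x • F x := by
        rw [Lp.toTemperedDistribution_apply]
        refine integral_congr_ae ?_
        filter_upwards [h2.coeFn_toLp] with x hx
        rw [hx, SchwartzMap.fourierInv_coe]
    _ = ∫ x, φ x • 𝓕⁻ F x := by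
        have := VectorFourier.integral_fourierIntegral_smul_eq_flip (μ := volume) (ν := volume)
          (L := -innerₗ (EuclideanSpace ℝ (Fin d))) (f := φ) (g := F)
          Real.continuous_fourierChar (by simpa using! continuous_inner.neg) φ.integrable h1
        have hfl : (-innerₗ (EuclideanSpace ℝ (Fin d))).flip = -innerₗ _ := by
          ext x y
          simp [real_inner_comm]
        rw [hfl] at this
        exact this
    _ = _ := by simp [hφ]

end Fourier

/-! ### Sobolev spaces as Banach algebras -/

section Sobolev

variable {d : ℕ}

/-- The weight `(1 + |η|²)^{k/2}`, `η = 2πξ`, of the Sobolev norm. -/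
def weight (k : ℕ) (ξ : EuclideanSpace ℝ (Fin d)) : ℝ :=
  (1 + (2 * Real.pi * ‖ξ‖) ^ 2) ^ ((k : ℝ) / 2)

theorem one_le_weight (k : ℕ) (ξ : EuclideanSpace ℝ (Fin d)) : 1 ≤ weight k ξ :=
  Real.one_le_rpow (by nlinarith [sq_nonneg (2 * Real.pi * ‖ξ‖)]) (by positivity)

theorem weight_pos (k : ℕ) (ξ : EuclideanSpace ℝ (Fin d)) : 0 < weight k ξ :=
  one_pos.trans_le (one_le_weight k ξ)

theorem weight_mono {k l : ℕ} (h : k ≤ l) (ξ : EuclideanSpace ℝ (Fin d)) :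
    weight k ξ ≤ weight l ξ := by
  have : (k : ℝ) ≤ l := by exact_mod_cast h
  exact Real.rpow_le_rpow_of_exponent_le (by nlinarith [sq_nonneg (2 * Real.pi * ‖ξ‖)])
    (by linarith)

theorem weight_add_two (k : ℕ) (ξ : EuclideanSpace ℝ (Fin d)) :
    weight (k + 2) ξ = weight k ξ * (1 + (2 * Real.pi * ‖ξ‖) ^ 2) := by
  have h : (0 : ℝ) < 1 + (2 * Real.pi * ‖ξ‖) ^ 2 := by positivity
  unfold weight
  rw [← Real.rpow_add_one h.ne']
  congr 1
  push_cast
  ring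

@[fun_prop]
theorem continuous_weight (k : ℕ) :
    Continuous (weight k : EuclideanSpace ℝ (Fin d) → ℝ) :=
  Continuous.rpow_const (by fun_prop) fun ξ => Or.inl (by positivity)

theorem weight_eq_sqrt_pow (k : ℕ) (ξ : EuclideanSpace ℝ (Fin d)) :
    weight k ξ = √(1 + (2 * Real.pi * ‖ξ‖) ^ 2) ^ k := by
  rw [weight, Real.sqrt_eq_rpow, ← Real.rpow_mul_natCast (by positivity)]
  congr 1
  ring

/-- The inequality behind the algebra property of `H^k`: up to a constant, the weight at a sum of
frequencies is bounded by the sum of the weights. -/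
theorem weight_le_add (k : ℕ) (ξ η : EuclideanSpace ℝ (Fin d)) :
    weight k ξ ≤ 2 ^ k * (weight k η + weight k (ξ - η)) := by
  simp only [weight_eq_sqrt_pow]
  set p := √(1 + (2 * Real.pi * ‖η‖) ^ 2)
  set q := √(1 + (2 * Real.pi * ‖ξ - η‖) ^ 2)
  have hp : 0 ≤ p := Real.sqrt_nonneg _
  have hq : 0 ≤ q := Real.sqrt_nonneg _
  have hp2 : p ^ 2 = 1 + (2 * Real.pi * ‖η‖) ^ 2 := Real.sq_sqrt (by positivity)
  have hq2 : q ^ 2 = 1 + (2 * Real.pi * ‖ξ - η‖) ^ 2 := Real.sq_sqrt (by positivity)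
  have hp' : 2 * Real.pi * ‖η‖ ≤ p := Real.le_sqrt_of_sq_le (by linarith)
  have hq' : 2 * Real.pi * ‖ξ - η‖ ≤ q := Real.le_sqrt_of_sq_le (by linarith)
  have htri : ‖ξ‖ ≤ ‖η‖ + ‖ξ - η‖ := by
    calc ‖ξ‖ = ‖η + (ξ - η)‖ := by rw [add_sub_cancel]
      _ ≤ _ := norm_add_le _ _
  have hpi := Real.pi_pos
  have h1 : √(1 + (2 * Real.pi * ‖ξ‖) ^ 2) ≤ p + q := by
    refine Real.sqrt_le_iff.2 ⟨by positivity, ?_⟩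
    have h2 : (2 * Real.pi * ‖ξ‖) ^ 2 ≤
        (2 * Real.pi * ‖η‖ + 2 * Real.pi * ‖ξ - η‖) ^ 2 := by
      gcongr
      rw [← mul_add]
      gcongr
    have h3 : (2 * Real.pi * ‖η‖) * (2 * Real.pi * ‖ξ - η‖) ≤ p * q := by gcongr
    nlinarith
  calc √(1 + (2 * Real.pi * ‖ξ‖) ^ 2) ^ k ≤ (p + q) ^ k := by gcongr
    _ ≤ (2 * max p q) ^ k := by
        gcongr
        linarith [le_max_left p q, le_max_right p q]
    _ = 2 ^ k * max p q ^ k := mul_pow _ _ _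
    _ ≤ 2 ^ k * (p ^ k + q ^ k) := by
        gcongr
        rcases max_cases p q with ⟨h, -⟩ | ⟨h, -⟩ <;> rw [h]
        · linarith [pow_nonneg hq k]
        · linarith [pow_nonneg hp k]

/-- For `k > d/2` the inverse of the weight is square integrable. -/
theorem memLp_inv_weight {k : ℕ} (hk : (d : ℝ) < 2 * k) :
    MemLp (fun ξ : EuclideanSpace ℝ (Fin d) => (((weight k ξ)⁻¹ : ℝ) : ℂ)) 2 volume := by
  have hk0 : (0 : ℝ) < k := by
    have : (0 : ℝ) ≤ d := Nat.cast_nonneg d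
    linarith
  have hm : Continuous fun ξ : EuclideanSpace ℝ (Fin d) => (weight k ξ)⁻¹ :=
    (continuous_weight k).inv₀ fun ξ => (weight_pos k ξ).ne'
  suffices h : MemLp (fun ξ : EuclideanSpace ℝ (Fin d) => (weight k ξ)⁻¹) 2 volume from h.ofReal
  rw [memLp_two_iff_integrable_sq hm.aestronglyMeasurable]
  have hint := integrable_rpow_neg_one_add_norm_sq (E := EuclideanSpace ℝ (Fin d))
    (μ := volume) (r := 2 * k) (by simpa using hk)
  refine hint.mono' (hm.pow 2).aestronglyMeasurable (Filter.Eventually.of_forall fun ξ => ?_)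
  have h1 : (0 : ℝ) < 1 + ‖ξ‖ ^ 2 := by positivity
  have h2 : 1 + ‖ξ‖ ^ 2 ≤ 1 + (2 * Real.pi * ‖ξ‖) ^ 2 := by
    have hpi : 1 ≤ 2 * Real.pi := by linarith [Real.pi_gt_three]
    have : ‖ξ‖ ≤ 2 * Real.pi * ‖ξ‖ := le_mul_of_one_le_left (norm_nonneg ξ) hpi
    gcongr
  rw [Real.norm_of_nonneg (by positivity), weight, inv_pow, ← Real.rpow_mul_natCast (by positivity),
    ← Real.rpow_neg (by positivity)]
  have e : -(2 * (k : ℝ)) / 2 = -((k : ℝ) / 2 * (2 : ℕ)) := by push_cast; ring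
  rw [e]
  exact Real.rpow_le_rpow_of_nonpos h1 h2 (by push_cast; linarith)

/-- `H^k` is parametrised by `L²`: the element `a` stands for the function with Fourier transform
`unweight k a = (1 + |η|²)^{-k/2} a`, so that its Sobolev norm is `‖a‖`. -/
def unweight (k : ℕ) (a : L2 d) (ξ : EuclideanSpace ℝ (Fin d)) : ℂ :=
  (((weight k ξ)⁻¹ : ℝ) : ℂ) * a ξ

theorem measurable_unweight (k : ℕ) (a : L2 d) : Measurable (unweight k a) :=
  (Complex.measurable_ofReal.comp (continuous_weight k).measurable.inv).mul
    (Lp.stronglyMeasurable a).measurable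

theorem weight_mul_unweight (k : ℕ) (a : L2 d) (ξ : EuclideanSpace ℝ (Fin d)) :
    (weight k ξ : ℂ) * unweight k a ξ = a ξ := by
  have : (weight k ξ : ℂ) ≠ 0 := by exact_mod_cast (weight_pos k ξ).ne'
  rw [unweight, Complex.ofReal_inv, mul_inv_cancel_left₀ this]

theorem memLp_unweight (k : ℕ) (a : L2 d) : MemLp (unweight k a) 2 volume := by
  refine (Lp.memLp a).of_le (measurable_unweight k a).aestronglyMeasurable
    (Filter.Eventually.of_forall fun ξ => ?_)
  rw [unweight, norm_mul, Complex.norm_real, Real.norm_of_nonneg (inv_nonneg.2 (weight_pos k ξ).le)]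
  exact mul_le_of_le_one_left (norm_nonneg _) (inv_le_one_of_one_le₀ (one_le_weight k ξ))

/-- The `L²` norm of the inverse weight, the constant of the embedding of `H^k` into the space of
functions with integrable Fourier transform. -/
def embConst {k : ℕ} (hk : (d : ℝ) < 2 * k) : ℝ := ‖(memLp_inv_weight hk).toLp _‖

theorem embConst_nonneg {k : ℕ} (hk : (d : ℝ) < 2 * k) : 0 ≤ embConst hk := norm_nonneg _

/-- Division by the weight, as a map from `L²` to `L¹`. -/
def unweightL {k : ℕ} (hk : (d : ℝ) < 2 * k) :
    L2 d →L[ℂ] Lp ℂ 1 (volume : Measure (EuclideanSpace ℝ (Fin d))) :=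
  (ContinuousLinearMap.mul ℂ ℂ).holderL volume 2 2 1 ((memLp_inv_weight hk).toLp _)

theorem unweightL_ae_eq {k : ℕ} (hk : (d : ℝ) < 2 * k) (a : L2 d) :
    unweightL hk a =ᵐ[volume] unweight k a := by
  filter_upwards [(ContinuousLinearMap.mul ℂ ℂ).coeFn_holder (r := 1)
    ((memLp_inv_weight hk).toLp _) a, (memLp_inv_weight hk).coeFn_toLp] with ξ h1 h2
  rw [ContinuousLinearMap.mul_apply', h2] at h1
  exact h1

theorem integrable_unweight {k : ℕ} (hk : (d : ℝ) < 2 * k) (a : L2 d) :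
    Integrable (unweight k a) :=
  (L1.integrable_coeFn (unweightL hk a)).congr (unweightL_ae_eq hk a)

theorem lintegral_enorm_unweight_le {k : ℕ} (hk : (d : ℝ) < 2 * k) (a : L2 d) :
    ∫⁻ ξ, ‖unweight k a ξ‖ₑ ≤ ENNReal.ofReal (embConst hk) * eLpNorm a 2 volume := by
  have h := eLpNorm_smul_le_mul_eLpNorm (p := 2) (q := 2) (r := 1) (Lp.aestronglyMeasurable a)
    (memLp_inv_weight hk).aestronglyMeasurable
  rw [eLpNorm_one_eq_lintegral_enorm] at h
  rw [embConst, Lp.norm_toLp, ENNReal.ofReal_toReal (memLp_inv_weight hk).eLpNorm_ne_top]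
  exact h

/-- The continuous function represented by `a`. -/
def sobolevFun {k : ℕ} (hk : (d : ℝ) < 2 * k) : L2 d →ₗ[ℂ] EuclideanSpace ℝ (Fin d) → ℂ where
  toFun a := Real.Lp.fourierTransformInvCLM _ _ (unweightL hk a)
  map_add' a b := by simp only [map_add, BoundedContinuousFunction.coe_add]
  map_smul' c a := by
    simp only [map_smul, BoundedContinuousFunction.coe_smul, RingHom.id_apply]
    rfl

theorem sobolevFun_eq {k : ℕ} (hk : (d : ℝ) < 2 * k) (a : L2 d) :
    sobolevFun hk a = 𝓕⁻ (unweight k a) := by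
  ext x
  change Real.Lp.fourierTransformInv (unweightL hk a) x = _
  rw [Real.Lp.fourierTransformInv_apply]
  exact Real.fourierInv_congr_ae (unweightL_ae_eq hk a) x

theorem sobolevFun_ae_eq {k : ℕ} (hk : (d : ℝ) < 2 * k) (a : L2 d) :
    (𝓕⁻ ((memLp_unweight k a).toLp _) : L2 d) =ᵐ[volume] sobolevFun hk a := by
  rw [sobolevFun_eq]
  exact fourierInv_toLp_ae_eq (integrable_unweight hk a) (memLp_unweight k a)

theorem sobolevFun_injective {k : ℕ} (hk : (d : ℝ) < 2 * k) :
    Function.Injective (sobolevFun hk : L2 d →ₗ[ℂ] _) := by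
  intro a b hab
  have h1 : (𝓕⁻ ((memLp_unweight k a).toLp _) : L2 d) = 𝓕⁻ ((memLp_unweight k b).toLp _) := by
    refine Lp.ext ((sobolevFun_ae_eq hk a).trans ?_)
    rw [hab]
    exact (sobolevFun_ae_eq hk b).symm
  have h2 := congrArg (fun f : L2 d => 𝓕 f) h1
  simp only [FourierTransform.fourier_fourierInv_eq] at h2
  refine Lp.ext ?_
  filter_upwards [(memLp_unweight k a).coeFn_toLp, (memLp_unweight k b).coeFn_toLp] with ξ ha hb
  rw [← weight_mul_unweight k a, ← weight_mul_unweight k b, ← ha, ← hb, h2]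

theorem sobolevFun_eq_of_ae {k : ℕ} (hk : (d : ℝ) < 2 * k) {F : EuclideanSpace ℝ (Fin d) → ℂ}
    (c : L2 d) (hc : c =ᵐ[volume] fun ξ => (weight k ξ : ℂ) * F ξ) :
    sobolevFun hk c = 𝓕⁻ F := by
  rw [sobolevFun_eq]
  ext x
  refine Real.fourierInv_congr_ae ?_ x
  filter_upwards [hc] with ξ hξ
  have : (weight k ξ : ℂ) ≠ 0 := by exact_mod_cast (weight_pos k ξ).ne'
  rw [unweight, hξ, Complex.ofReal_inv, inv_mul_cancel_left₀ this]

open scoped Convolution in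
/-- The convolution estimate behind the algebra property of `H^k`, `k > d/2`. -/
theorem eLpNorm_weight_mul_convolution_le {k : ℕ} (hk : (d : ℝ) < 2 * k) (a b : L2 d) :
    eLpNorm (fun ξ => (weight k ξ : ℂ) *
      (unweight k a ⋆[ContinuousLinearMap.mul ℂ ℂ] unweight k b) ξ) 2 volume ≤
      ENNReal.ofReal (2 ^ (k + 1) * embConst hk) * eLpNorm a 2 volume * eLpNorm b 2 volume := by
  set F := unweight k a with hF
  set G := unweight k b with hG
  have mF : Measurable F := measurable_unweight k a
  have mG : Measurable G := measurable_unweight k b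
  have ma : Measurable a := (Lp.stronglyMeasurable a).measurable
  have mb : Measurable b := (Lp.stronglyMeasurable b).measurable
  have wmul : ∀ (c : L2 d) ξ, ENNReal.ofReal (weight k ξ) * ‖unweight k c ξ‖ₑ = ‖c ξ‖ₑ := by
    intro c ξ
    rw [← weight_mul_unweight k c ξ, enorm_mul]
    congr 1
    rw [← ofReal_norm, Complex.norm_real, Real.norm_of_nonneg (weight_pos k ξ).le]
  -- pointwise bound by two convolutions, in each of which one factor carries the weight
  have pt : ∀ ξ, ‖(weight k ξ : ℂ) * (F ⋆[ContinuousLinearMap.mul ℂ ℂ] G) ξ‖ₑ ≤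
      2 ^ k * ((∫⁻ η, ‖G η‖ₑ * ‖a (ξ - η)‖ₑ) + ∫⁻ η, ‖F η‖ₑ * ‖b (ξ - η)‖ₑ) := by
    intro ξ
    have e : ∫⁻ η, ‖G η‖ₑ * ‖a (ξ - η)‖ₑ = ∫⁻ η, ‖a η‖ₑ * ‖G (ξ - η)‖ₑ := by
      rw [← lintegral_sub_left_eq_self (fun η => ‖a η‖ₑ * ‖G (ξ - η)‖ₑ) ξ]
      simp only [sub_sub_cancel, mul_comm]
    rw [e, ← lintegral_add_left (by fun_prop), ← lintegral_const_mul _ (by fun_prop), enorm_mul,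
      ← ofReal_norm (weight k ξ : ℂ), Complex.norm_real,
      Real.norm_of_nonneg (weight_pos k ξ).le]
    calc ENNReal.ofReal (weight k ξ) * ‖(F ⋆[ContinuousLinearMap.mul ℂ ℂ] G) ξ‖ₑ
        ≤ ENNReal.ofReal (weight k ξ) * ∫⁻ η, ‖F η‖ₑ * ‖G (ξ - η)‖ₑ := by
          gcongr
          refine (enorm_integral_le_lintegral_enorm _).trans (le_of_eq ?_)
          simp only [ContinuousLinearMap.mul_apply', enorm_mul]
      _ = ∫⁻ η, ENNReal.ofReal (weight k ξ) * (‖F η‖ₑ * ‖G (ξ - η)‖ₑ) :=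
          (lintegral_const_mul _ (by fun_prop)).symm
      _ ≤ _ := by
          refine lintegral_mono fun η => ?_
          calc ENNReal.ofReal (weight k ξ) * (‖F η‖ₑ * ‖G (ξ - η)‖ₑ)
              ≤ (2 ^ k * (ENNReal.ofReal (weight k η) + ENNReal.ofReal (weight k (ξ - η)))) *
                  (‖F η‖ₑ * ‖G (ξ - η)‖ₑ) := by
                gcongr
                refine (ENNReal.ofReal_le_ofReal (weight_le_add k ξ η)).trans (le_of_eq ?_)
                rw [ENNReal.ofReal_mul (by positivity), ENNReal.ofReal_pow (by norm_num),
                  ENNReal.ofReal_add (weight_pos k η).le (weight_pos k _).le]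
                norm_num
            _ = 2 ^ k * ((ENNReal.ofReal (weight k η) * ‖F η‖ₑ) * ‖G (ξ - η)‖ₑ +
                  ‖F η‖ₑ * (ENNReal.ofReal (weight k (ξ - η)) * ‖G (ξ - η)‖ₑ)) := by ring
            _ = _ := by rw [hF, hG, wmul a, wmul b]
  set A := eLpNorm a 2 volume
  set B := eLpNorm b 2 volume
  set D := ENNReal.ofReal (embConst hk) with hD
  have young : ∀ c c' : L2 d, ∫⁻ ξ, (∫⁻ η, ‖unweight k c η‖ₑ * ‖c' (ξ - η)‖ₑ) ^ 2 ≤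
      (D * eLpNorm c 2 volume * eLpNorm c' 2 volume) ^ 2 := by
    intro c c'
    refine (lintegral_conv_sq_le (measurable_unweight k c).enorm
      (Lp.stronglyMeasurable c').measurable.enorm).trans ?_
    rw [mul_pow, eLpNorm_two_sq c']
    gcongr
    exact lintegral_enorm_unweight_le hk c
  have sq_add : ∀ p q : ℝ≥0∞, (p + q) ^ 2 ≤ 2 * (p ^ 2 + q ^ 2) := by
    intro p q
    have h := ENNReal.rpow_add_le_mul_rpow_add_rpow p q (p := 2) (by norm_num)
    norm_num at h
    exact_mod_cast h
  have key : eLpNorm (fun ξ => (weight k ξ : ℂ) * (F ⋆[ContinuousLinearMap.mul ℂ ℂ] G) ξ) 2 volume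
      ^ 2 ≤ (2 ^ (k + 1) * D * A * B) ^ 2 := by
    rw [eLpNorm_two_sq]
    calc _ ≤ ∫⁻ ξ, (2 ^ k) ^ 2 * (2 * ((∫⁻ η, ‖G η‖ₑ * ‖a (ξ - η)‖ₑ) ^ 2 +
            (∫⁻ η, ‖F η‖ₑ * ‖b (ξ - η)‖ₑ) ^ 2)) := by
          refine lintegral_mono fun ξ => ?_
          refine (pow_le_pow_left' (pt ξ) 2).trans ?_
          rw [mul_pow]
          gcongr
          exact sq_add _ _
      _ = (2 ^ k) ^ 2 * (2 * ((∫⁻ ξ, (∫⁻ η, ‖G η‖ₑ * ‖a (ξ - η)‖ₑ) ^ 2) +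
            ∫⁻ ξ, (∫⁻ η, ‖F η‖ₑ * ‖b (ξ - η)‖ₑ) ^ 2)) := by
          have m1 : Measurable fun ξ => (∫⁻ η, ‖G η‖ₑ * ‖a (ξ - η)‖ₑ) ^ 2 :=
            (Measurable.lintegral_prod_right' (f := fun p :
              EuclideanSpace ℝ (Fin d) × EuclideanSpace ℝ (Fin d) => ‖G p.2‖ₑ * ‖a (p.1 - p.2)‖ₑ)
              (by fun_prop)).pow_const 2
          have m2 : Measurable fun ξ => (∫⁻ η, ‖F η‖ₑ * ‖b (ξ - η)‖ₑ) ^ 2 :=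
            (Measurable.lintegral_prod_right' (f := fun p :
              EuclideanSpace ℝ (Fin d) × EuclideanSpace ℝ (Fin d) => ‖F p.2‖ₑ * ‖b (p.1 - p.2)‖ₑ)
              (by fun_prop)).pow_const 2
          rw [lintegral_const_mul _ (by fun_prop), lintegral_const_mul _ (by fun_prop),
            lintegral_add_left m1]
      _ ≤ (2 ^ k) ^ 2 * (2 * ((D * B * A) ^ 2 + (D * A * B) ^ 2)) := by
          gcongr
          · exact young b a
          · exact young a b
      _ = _ := by ring
  have key' := (ENNReal.pow_le_pow_left_iff two_ne_zero).1 key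
  rwa [ENNReal.ofReal_mul (by positivity), ENNReal.ofReal_pow (by norm_num), ENNReal.ofReal_ofNat]

/-- For `k > d/2`, the space `H^k` is an algebra of functions. -/
theorem isFunctionAlgebra_sobolevFun {k : ℕ} (hk : (d : ℝ) < 2 * k) :
    IsFunctionAlgebra (sobolevFun hk) (2 ^ (k + 1) * embConst hk) where
  nonneg := mul_nonneg (by positivity) (embConst_nonneg hk)
  injective := sobolevFun_injective hk
  continuous x := by
    exact ((BoundedContinuousFunction.evalCLM ℂ x).comp
      ((Real.Lp.fourierTransformInvCLM _ _).comp (unweightL hk))).continuous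
  exists_mul a b := by
    have hFG := (integrable_unweight hk a).integrable_convolution
      (ContinuousLinearMap.mul ℂ ℂ) (integrable_unweight hk b)
    have hle := eLpNorm_weight_mul_convolution_le hk a b
    have hfin : ENNReal.ofReal (2 ^ (k + 1) * embConst hk) * eLpNorm a 2 volume *
        eLpNorm b 2 volume ≠ ⊤ :=
      ENNReal.mul_ne_top (ENNReal.mul_ne_top ENNReal.ofReal_ne_top (Lp.eLpNorm_ne_top a))
        (Lp.eLpNorm_ne_top b)
    have hmem : MemLp (fun ξ => (weight k ξ : ℂ) * MeasureTheory.convolution (unweight k a)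
        (unweight k b) (ContinuousLinearMap.mul ℂ ℂ) volume ξ) 2 volume :=
      ⟨(Complex.continuous_ofReal.comp (continuous_weight k)).aestronglyMeasurable.mul
        hFG.aestronglyMeasurable, hle.trans_lt hfin.lt_top⟩
    refine ⟨hmem.toLp _, ?_, ?_⟩
    · rw [sobolevFun_eq_of_ae hk _ hmem.coeFn_toLp, sobolevFun_eq, sobolevFun_eq]
      ext x
      rw [Pi.mul_apply, Real.fourierInv_eq_fourier_neg, Real.fourierInv_eq_fourier_neg,
        Real.fourierInv_eq_fourier_neg]
      exact Real.fourier_mul_convolution_eq (integrable_unweight hk a) (integrable_unweight hk b) _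
    · rw [Lp.norm_toLp, Lp.norm_def, Lp.norm_def,
        ← ENNReal.toReal_ofReal (mul_nonneg (by positivity : (0 : ℝ) ≤ 2 ^ (k + 1))
          (embConst_nonneg hk)), ← ENNReal.toReal_mul, ← ENNReal.toReal_mul]
      exact ENNReal.toReal_mono hfin hle
  exists_conj a := by
    have hneg : MeasurePreserving (fun ξ : EuclideanSpace ℝ (Fin d) => -ξ) volume volume :=
      Measure.measurePreserving_neg _
    have hmem : MemLp (fun ξ => starRingEnd ℂ (a (-ξ))) 2 volume :=
      ((Lp.memLp a).comp_measurePreserving hneg).star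
    refine ⟨hmem.toLp _, ?_, ?_⟩
    · rw [sobolevFun_eq_of_ae hk (F := fun ξ => starRingEnd ℂ (unweight k a (-ξ))) _ ?_,
        sobolevFun_eq]
      · ext x
        rw [Real.fourierInv_eq', Real.fourierInv_eq', ← integral_conj,
          ← integral_neg_eq_self]
        congr 1
        ext ξ
        simp [← Complex.exp_conj, map_ofNat]
      · filter_upwards [hmem.coeFn_toLp] with ξ hξ
        rw [hξ, ← weight_mul_unweight k a (-ξ), map_mul, Complex.conj_ofReal]
        simp [weight]
    · rw [Lp.norm_toLp, Lp.norm_def]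
      refine ENNReal.toReal_mono (Lp.eLpNorm_ne_top a) (le_of_eq ?_)
      calc _ = eLpNorm (fun ξ => a (-ξ)) 2 volume := eLpNorm_congr_norm_ae
            (Filter.Eventually.of_forall fun ξ => by simp)
        _ = _ := eLpNorm_comp_measurePreserving (Lp.aestronglyMeasurable a) hneg

end Sobolev


/-! ### The Sobolev norm on `L²` -/

section SobolevNorm

variable {d : ℕ}

theorem sobolevNorm_eq (k : ℕ) (f : L2 d) :
    sobolevNorm k f = eLpNorm (fun ξ => (weight k ξ : ℂ) * (𝓕 f : L2 d) ξ) 2 volume := rfl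

theorem aestronglyMeasurable_weight_mul (k : ℕ) (f : L2 d) :
    AEStronglyMeasurable (fun ξ => (weight k ξ : ℂ) * f ξ) volume :=
  (Complex.continuous_ofReal.comp (continuous_weight k)).aestronglyMeasurable.mul
    (Lp.aestronglyMeasurable f)

theorem sobolevNorm_add_le (k : ℕ) (f g : L2 d) :
    sobolevNorm k (f + g) ≤ sobolevNorm k f + sobolevNorm k g := by
  simp only [sobolevNorm_eq, FourierTransform.fourier_add]
  refine le_trans (le_of_eq (eLpNorm_congr_ae ?_)) (eLpNorm_add_le
    (aestronglyMeasurable_weight_mul k (𝓕 f)) (aestronglyMeasurable_weight_mul k (𝓕 g))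
    one_le_two)
  filter_upwards [Lp.coeFn_add (𝓕 f : L2 d) (𝓕 g)] with ξ h
  rw [h, Pi.add_apply, Pi.add_apply, mul_add]

theorem sobolevNorm_smul (k : ℕ) (c : ℂ) (f : L2 d) :
    sobolevNorm k (c • f) = ‖c‖ₑ * sobolevNorm k f := by
  simp only [sobolevNorm_eq, FourierTransform.fourier_smul]
  rw [← eLpNorm_const_smul]
  refine eLpNorm_congr_ae ?_
  filter_upwards [Lp.coeFn_smul c (𝓕 f : L2 d)] with ξ h
  rw [h, Pi.smul_apply, Pi.smul_apply, smul_eq_mul, smul_eq_mul, mul_left_comm]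

theorem sobolevNorm_neg (k : ℕ) (f : L2 d) : sobolevNorm k (-f) = sobolevNorm k f := by
  rw [← neg_one_smul ℂ f, sobolevNorm_smul]
  simp

theorem sobolevNorm_sub_comm (k : ℕ) (f g : L2 d) :
    sobolevNorm k (f - g) = sobolevNorm k (g - f) := by
  rw [← neg_sub, sobolevNorm_neg]

theorem sobolevNorm_zero (k : ℕ) : sobolevNorm k (0 : L2 d) = 0 := by
  rw [← zero_smul ℂ (0 : L2 d), sobolevNorm_smul]
  simp

theorem sobolevNorm_mono {k l : ℕ} (h : k ≤ l) (f : L2 d) : sobolevNorm k f ≤ sobolevNorm l f := by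
  simp only [sobolevNorm_eq]
  refine eLpNorm_mono fun ξ => ?_
  rw [norm_mul, norm_mul, Complex.norm_real, Complex.norm_real]
  gcongr
  rw [Real.norm_of_nonneg (weight_pos k ξ).le, Real.norm_of_nonneg (weight_pos l ξ).le]
  exact weight_mono h ξ

theorem enorm_le_sobolevNorm (k : ℕ) (f : L2 d) : ‖f‖ₑ ≤ sobolevNorm k f := by
  have h : ‖f‖ₑ = ‖(𝓕 f : L2 d)‖ₑ := by
    rw [← ofReal_norm, ← ofReal_norm, Lp.norm_fourier_eq]
  rw [h, Lp.enorm_def, sobolevNorm_eq]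
  refine eLpNorm_mono fun ξ => ?_
  rw [norm_mul, Complex.norm_real, Real.norm_of_nonneg (weight_pos k ξ).le]
  exact le_mul_of_one_le_left (norm_nonneg _) (one_le_weight k ξ)

theorem exists_sobolevFun {k : ℕ} (hk : (d : ℝ) < 2 * k) {f : L2 d} (hf : sobolevNorm k f ≠ ⊤) :
    ∃ a : L2 d, f =ᵐ[volume] sobolevFun hk a := by
  have hmem : MemLp (fun ξ => (weight k ξ : ℂ) * (𝓕 f : L2 d) ξ) 2 volume :=
    ⟨aestronglyMeasurable_weight_mul k _, hf.lt_top⟩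
  refine ⟨hmem.toLp _, ?_⟩
  refine Filter.EventuallyEq.trans ?_ (sobolevFun_ae_eq hk _)
  have h : (𝓕 f : L2 d) = (memLp_unweight k (hmem.toLp _)).toLp _ := by
    refine Lp.ext ?_
    filter_upwards [hmem.coeFn_toLp, (memLp_unweight k (hmem.toLp _)).coeFn_toLp] with ξ h1 h2
    have : (weight k ξ : ℂ) ≠ 0 := by exact_mod_cast (weight_pos k ξ).ne'
    rw [h2, unweight, h1, Complex.ofReal_inv, inv_mul_cancel_left₀ this]
  rw [← h, FourierTransform.fourierInv_fourier_eq]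

theorem sobolevNorm_eq_of_ae {k : ℕ} (hk : (d : ℝ) < 2 * k) {g c : L2 d}
    (h : g =ᵐ[volume] sobolevFun hk c) : sobolevNorm k g = ENNReal.ofReal ‖c‖ := by
  have e : g = 𝓕⁻ ((memLp_unweight k c).toLp _) := Lp.ext (h.trans (sobolevFun_ae_eq hk c).symm)
  rw [e, sobolevNorm_eq, FourierTransform.fourier_fourierInv_eq, ofReal_norm, Lp.enorm_def]
  refine eLpNorm_congr_ae ?_
  filter_upwards [(memLp_unweight k c).coeFn_toLp] with ξ hξ
  rw [hξ, weight_mul_unweight]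

theorem sub_ae_eq_sobolevFun {k : ℕ} (hk : (d : ℝ) < 2 * k) {f g a b : L2 d}
    (hf : f =ᵐ[volume] sobolevFun hk a) (hg : g =ᵐ[volume] sobolevFun hk b) :
    (f - g : L2 d) =ᵐ[volume] sobolevFun hk (a - b) := by
  filter_upwards [Lp.coeFn_sub f g, hf, hg] with x h1 h2 h3
  rw [h1, map_sub, Pi.sub_apply, Pi.sub_apply, h2, h3]

theorem exists_sobolevFun_of_le {k : ℕ} (hk : (d : ℝ) < 2 * k) {f : L2 d} {R : ℝ} (hR : 0 ≤ R)
    (hf : sobolevNorm k f ≤ ENNReal.ofReal R) :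
    ∃ a : L2 d, f =ᵐ[volume] sobolevFun hk a ∧ ‖a‖ ≤ R := by
  obtain ⟨a, ha⟩ := exists_sobolevFun hk (hf.trans_lt ENNReal.ofReal_lt_top).ne
  refine ⟨a, ha, ?_⟩
  rwa [sobolevNorm_eq_of_ae hk ha, ENNReal.ofReal_le_ofReal_iff hR] at hf

end SobolevNorm

/-! ### The cubic nonlinearity and its flow in Sobolev spaces -/

section Nonlinear

variable {d : ℕ}

theorem nonlinearFlow_ae_eq (μ τ : ℝ) (f : L2 d) : nonlinearFlow μ τ f =ᵐ[volume]
    fun x => Complex.exp (Complex.I * ((-(τ * μ * ‖f x‖ ^ 2) : ℝ) : ℂ)) * f x :=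
  MemLp.coeFn_toLp (memLp_phase_mul (aestronglyMeasurable_cubic_phase (τ * μ) f) f)

theorem nonlinearFlow_ae_eq_sobolevFun {k : ℕ} (hk : (d : ℝ) < 2 * k) (μ τ : ℝ) {f a : L2 d}
    (hf : f =ᵐ[volume] sobolevFun hk a) : nonlinearFlow μ τ f =ᵐ[volume]
      sobolevFun hk ((isFunctionAlgebra_sobolevFun hk).phaseRot (τ * μ) a) := by
  filter_upwards [nonlinearFlow_ae_eq μ τ f, hf] with x h1 h2
  rw [h1, h2, IsFunctionAlgebra.map_phaseRot]

theorem cubic_ae_eq_sobolevFun {k : ℕ} (hk : (d : ℝ) < 2 * k) {f c a : L2 d}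
    (hc : c =ᵐ[volume] fun x => ((‖f x‖ ^ 2 : ℝ) : ℂ) * f x)
    (hf : f =ᵐ[volume] sobolevFun hk a) :
    c =ᵐ[volume] sobolevFun hk ((isFunctionAlgebra_sobolevFun hk).cubic a) := by
  filter_upwards [hc, hf] with x h1 h2
  rw [h1, h2, IsFunctionAlgebra.map_cubic]

/-- Stability: the nonlinear flow is Lipschitz on bounded sets of `H^k`, with a constant
`1 + O(τ)`. -/
theorem exists_sobolevNorm_nonlinearFlow_sub_le {k : ℕ} (hk : (d : ℝ) < 2 * k) (μ : ℝ) {T R : ℝ}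
    (hT : 0 ≤ T) (hR : 0 ≤ R) : ∃ C : ℝ, 0 ≤ C ∧ ∀ τ : ℝ, 0 ≤ τ → τ ≤ T → ∀ f g : L2 d,
      sobolevNorm k f ≤ ENNReal.ofReal R → sobolevNorm k g ≤ ENNReal.ofReal R →
      sobolevNorm k (nonlinearFlow μ τ f - nonlinearFlow μ τ g) ≤
        ENNReal.ofReal (1 + C * τ) * sobolevNorm k (f - g) := by
  have h := isFunctionAlgebra_sobolevFun hk
  set K := 2 ^ (k + 1) * embConst hk
  have hK : 0 ≤ K := h.nonneg
  refine ⟨3 * (K ^ 2 * R ^ 2) * (1 + T * |μ| * (K ^ 2 * R ^ 2)) *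
    Real.exp (3 * (T * |μ| * (K ^ 2 * R ^ 2))) * |μ|, by positivity, fun τ hτ0 hτ f g hf hg => ?_⟩
  obtain ⟨a, ha, na⟩ := exists_sobolevFun_of_le hk hR hf
  obtain ⟨b, hb, nb⟩ := exists_sobolevFun_of_le hk hR hg
  rw [sobolevNorm_eq_of_ae hk (sub_ae_eq_sobolevFun hk (nonlinearFlow_ae_eq_sobolevFun hk μ τ ha)
      (nonlinearFlow_ae_eq_sobolevFun hk μ τ hb)),
    sobolevNorm_eq_of_ae hk (sub_ae_eq_sobolevFun hk ha hb), ← ENNReal.ofReal_mul (by positivity)]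
  refine ENNReal.ofReal_le_ofReal ?_
  have habs : |τ * μ| = τ * |μ| := by rw [abs_mul, abs_of_nonneg hτ0]
  have hle : |τ * μ| ≤ T * |μ| := by rw [habs]; gcongr
  refine (h.norm_phaseRot_sub_le hle na nb).trans (le_of_eq ?_)
  rw [habs]
  ring

theorem exists_sobolevNorm_nonlinearFlow_taylor_le {k : ℕ} (hk : (d : ℝ) < 2 * k) (μ : ℝ)
    {T R : ℝ} (hR : 0 ≤ R) : ∃ C : ℝ, 0 ≤ C ∧ ∀ τ : ℝ, 0 ≤ τ → τ ≤ T →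
      ∀ f c : L2 d, sobolevNorm k f ≤ ENNReal.ofReal R →
      c =ᵐ[volume] (fun x => ((‖f x‖ ^ 2 : ℝ) : ℂ) * f x) →
      sobolevNorm k (nonlinearFlow μ τ f - f + (Complex.I * ((τ * μ : ℝ) : ℂ)) • c) ≤
        ENNReal.ofReal (C * τ ^ 2) := by
  have h := isFunctionAlgebra_sobolevFun hk
  set K := 2 ^ (k + 1) * embConst hk
  refine ⟨(K ^ 2 * R ^ 2) ^ 2 * Real.exp (T * |μ| * (K ^ 2 * R ^ 2)) * R * μ ^ 2, by positivity,
    fun τ hτ0 hτ f c hf hc => ?_⟩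
  obtain ⟨a, ha, na⟩ := exists_sobolevFun_of_le hk hR hf
  have hae : (nonlinearFlow μ τ f - f + (Complex.I * ((τ * μ : ℝ) : ℂ)) • c : L2 d) =ᵐ[volume]
      sobolevFun hk (h.phaseRot (τ * μ) a - a + (Complex.I * ((τ * μ : ℝ) : ℂ)) • h.cubic a) := by
    filter_upwards [sub_ae_eq_sobolevFun hk (nonlinearFlow_ae_eq_sobolevFun hk μ τ ha) ha,
      cubic_ae_eq_sobolevFun hk hc ha,
      Lp.coeFn_add (nonlinearFlow μ τ f - f) ((Complex.I * ((τ * μ : ℝ) : ℂ)) • c),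
      Lp.coeFn_smul (Complex.I * ((τ * μ : ℝ) : ℂ)) c] with x h1 h2 h3 h4
    rw [h3, Pi.add_apply, h1, h4, Pi.smul_apply, h2, map_add, map_smul, Pi.add_apply, Pi.smul_apply]
  rw [sobolevNorm_eq_of_ae hk hae]
  refine ENNReal.ofReal_le_ofReal ?_
  have hle : |τ * μ| ≤ T * |μ| := by rw [abs_mul, abs_of_nonneg hτ0]; gcongr
  refine (h.norm_phaseRot_sub_taylor_le hle na).trans (le_of_eq ?_)
  ring

theorem exists_sobolevNorm_cubic_le {k : ℕ} (hk : (d : ℝ) < 2 * k) {R : ℝ} (hR : 0 ≤ R) :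
    ∃ C : ℝ, 0 ≤ C ∧ ∀ f c : L2 d, sobolevNorm k f ≤ ENNReal.ofReal R →
      c =ᵐ[volume] (fun x => ((‖f x‖ ^ 2 : ℝ) : ℂ) * f x) →
      sobolevNorm k c ≤ ENNReal.ofReal C := by
  have h := isFunctionAlgebra_sobolevFun hk
  refine ⟨(2 ^ (k + 1) * embConst hk) ^ 2 * R ^ 3, by positivity, fun f c hf hc => ?_⟩
  obtain ⟨a, ha, na⟩ := exists_sobolevFun_of_le hk hR hf
  rw [sobolevNorm_eq_of_ae hk (cubic_ae_eq_sobolevFun hk hc ha)]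
  exact ENNReal.ofReal_le_ofReal (h.norm_cubic_le na)

theorem exists_sobolevNorm_cubic_sub_le {k : ℕ} (hk : (d : ℝ) < 2 * k) {R : ℝ} (hR : 0 ≤ R) :
    ∃ C : ℝ, 0 ≤ C ∧ ∀ f g c c' : L2 d, sobolevNorm k f ≤ ENNReal.ofReal R →
      sobolevNorm k g ≤ ENNReal.ofReal R →
      c =ᵐ[volume] (fun x => ((‖f x‖ ^ 2 : ℝ) : ℂ) * f x) →
      c' =ᵐ[volume] (fun x => ((‖g x‖ ^ 2 : ℝ) : ℂ) * g x) →
      sobolevNorm k (c - c') ≤ ENNReal.ofReal C * sobolevNorm k (f - g) := by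
  have h := isFunctionAlgebra_sobolevFun hk
  refine ⟨3 * (2 ^ (k + 1) * embConst hk) ^ 2 * R ^ 2, by positivity,
    fun f g c c' hf hg hc hc' => ?_⟩
  obtain ⟨a, ha, na⟩ := exists_sobolevFun_of_le hk hR hf
  obtain ⟨b, hb, nb⟩ := exists_sobolevFun_of_le hk hR hg
  rw [sobolevNorm_eq_of_ae hk (sub_ae_eq_sobolevFun hk (cubic_ae_eq_sobolevFun hk hc ha)
      (cubic_ae_eq_sobolevFun hk hc' hb)),
    sobolevNorm_eq_of_ae hk (sub_ae_eq_sobolevFun hk ha hb), ← ENNReal.ofReal_mul (by positivity)]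
  exact ENNReal.ofReal_le_ofReal (h.norm_cubic_sub_le na nb)

end Nonlinear

/-! ### The free Schrödinger flow in Sobolev spaces -/

section FreeFlow

variable {d : ℕ}

theorem fourier_freeFlow_ae_eq (t : ℝ) (f : L2 d) : (𝓕 (freeFlow t f) : L2 d) =ᵐ[volume]
    fun ξ => Complex.exp (Complex.I * ((-(t * (2 * Real.pi * ‖ξ‖) ^ 2) : ℝ) : ℂ)) *
      (𝓕 f : L2 d) ξ := by
  rw [freeFlow, FourierTransform.fourier_fourierInv_eq]
  exact MemLp.coeFn_toLp _

theorem L2.ext_fourier {f g : L2 d} (h : (𝓕 f : L2 d) =ᵐ[volume] (𝓕 g : L2 d)) : f = g :=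
  (Lp.fourierTransformₗᵢ _ _).injective (Lp.ext h)

theorem L2.fourier_sub (f g : L2 d) : (𝓕 (f - g) : L2 d) = 𝓕 f - 𝓕 g :=
  (Lp.fourierTransformₗᵢ _ _).map_sub f g

theorem freeFlow_sub (t : ℝ) (f g : L2 d) :
    freeFlow t (f - g) = freeFlow t f - freeFlow t g := by
  refine L2.ext_fourier ?_
  rw [L2.fourier_sub (freeFlow t f)]
  have e : (𝓕 (f - g) : L2 d) = 𝓕 f - 𝓕 g := L2.fourier_sub f g
  filter_upwards [fourier_freeFlow_ae_eq t (f - g), fourier_freeFlow_ae_eq t f,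
    fourier_freeFlow_ae_eq t g, Lp.coeFn_sub (𝓕 f : L2 d) (𝓕 g),
    Lp.coeFn_sub (𝓕 (freeFlow t f) : L2 d) (𝓕 (freeFlow t g))] with ξ h1 h2 h3 h4 h5
  rw [h1, h5, Pi.sub_apply, h2, h3, e, h4, Pi.sub_apply, mul_sub]

theorem freeFlow_neg_freeFlow (t : ℝ) (f : L2 d) : freeFlow (-t) (freeFlow t f) = f := by
  refine L2.ext_fourier ?_
  filter_upwards [fourier_freeFlow_ae_eq (-t) (freeFlow t f), fourier_freeFlow_ae_eq t f]
    with ξ h1 h2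
  rw [h1, h2, ← mul_assoc, ← Complex.exp_add, ← mul_add, ← Complex.ofReal_add]
  simp

theorem freeFlow_zero (f : L2 d) : freeFlow 0 f = f := by
  refine L2.ext_fourier ?_
  filter_upwards [fourier_freeFlow_ae_eq 0 f] with ξ h1
  rw [h1]
  simp

theorem sobolevNorm_freeFlow (k : ℕ) (t : ℝ) (f : L2 d) :
    sobolevNorm k (freeFlow t f) = sobolevNorm k f := by
  refine eLpNorm_congr_norm_ae ?_
  filter_upwards [fourier_freeFlow_ae_eq t f] with ξ h
  rw [h, norm_mul, norm_mul, norm_mul, Complex.norm_exp_I_mul_ofReal, one_mul]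

/-- `e^{itΔ} - 1 = O(t)` from `H^{k+2}` to `H^k`, since `|e^{-it|η|²} - 1| ≤ |t||η|²`. -/
theorem sobolevNorm_freeFlow_sub_le (k : ℕ) (t : ℝ) (f : L2 d) :
    sobolevNorm k (freeFlow t f - f) ≤ ENNReal.ofReal |t| * sobolevNorm (k + 2) f := by
  have e : (𝓕 (freeFlow t f - f) : L2 d) = 𝓕 (freeFlow t f) - 𝓕 f :=
    L2.fourier_sub _ _
  rw [sobolevNorm_eq, sobolevNorm_eq]
  refine eLpNorm_le_mul_eLpNorm_of_ae_le_mul ?_ 2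
  filter_upwards [fourier_freeFlow_ae_eq t f,
    Lp.coeFn_sub (𝓕 (freeFlow t f) : L2 d) (𝓕 f)] with ξ h3 h4
  have h5 : (𝓕 (freeFlow t f - f) : L2 d) ξ =
      (Complex.exp (Complex.I * ((-(t * (2 * Real.pi * ‖ξ‖) ^ 2) : ℝ) : ℂ)) - 1) *
        (𝓕 f : L2 d) ξ := by
    rw [e, h4, Pi.sub_apply, h3, sub_mul, one_mul]
  have h6 := Real.norm_exp_I_mul_ofReal_sub_one_le (x := -(t * (2 * Real.pi * ‖ξ‖) ^ 2))
  rw [norm_neg, norm_mul, Real.norm_eq_abs, Real.norm_of_nonneg (sq_nonneg _)] at h6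
  rw [h5, norm_mul, norm_mul, norm_mul, Complex.norm_real, Complex.norm_real,
    Real.norm_of_nonneg (weight_pos k ξ).le, Real.norm_of_nonneg (weight_pos (k + 2) ξ).le,
    weight_add_two]
  have hw := (weight_pos k ξ).le
  calc _ ≤ weight k ξ * ((|t| * (2 * Real.pi * ‖ξ‖) ^ 2) * ‖(𝓕 f : L2 d) ξ‖) := by gcongr
    _ ≤ weight k ξ * ((|t| * (1 + (2 * Real.pi * ‖ξ‖) ^ 2)) * ‖(𝓕 f : L2 d) ξ‖) := by
        gcongr
        linarith
    _ = _ := by ring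

end FreeFlow


/-! ### The exact flow in the interaction picture -/

section ExactFlow

variable {d : ℕ}

/-- The symbol `|η|² = (2π|ξ|)²` of `-Δ`. -/
def lapSymbol (ξ : EuclideanSpace ℝ (Fin d)) : ℝ := (2 * Real.pi * ‖ξ‖) ^ 2

@[fun_prop]
theorem continuous_lapSymbol : Continuous (lapSymbol : EuclideanSpace ℝ (Fin d) → ℝ) := by
  unfold lapSymbol
  fun_prop

/-- The symbol `(1 + |η|²)^{k/2} e^{iσ|η|²}` cut off to the ball `|ξ| ≤ r`. -/
def truncSymbol (k : ℕ) (r σ : ℝ) : EuclideanSpace ℝ (Fin d) → ℂ :=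
  (Metric.closedBall 0 r).indicator fun ξ =>
    (weight k ξ : ℂ) * Complex.exp (Complex.I * ((σ * lapSymbol ξ : ℝ) : ℂ))

theorem memLp_top_indicator_closedBall {g : EuclideanSpace ℝ (Fin d) → ℂ} (hg : Continuous g)
    (r : ℝ) : MemLp ((Metric.closedBall 0 r).indicator g) ⊤ volume := by
  obtain ⟨C, hC⟩ := (isCompact_closedBall (0 : EuclideanSpace ℝ (Fin d))
    r).exists_bound_of_continuousOn hg.continuousOn
  refine memLp_top_of_bound
    (hg.aestronglyMeasurable.indicator Metric.isClosed_closedBall.measurableSet) (max C 0)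
    (Filter.Eventually.of_forall fun ξ => ?_)
  by_cases hξ : ξ ∈ Metric.closedBall (0 : EuclideanSpace ℝ (Fin d)) r
  · rw [Set.indicator_of_mem hξ]
    exact (hC ξ hξ).trans (le_max_left _ _)
  · rw [Set.indicator_of_notMem hξ, norm_zero]
    exact le_max_right _ _

theorem memLp_truncSymbol (k : ℕ) (r σ : ℝ) :
    MemLp (truncSymbol k r σ : EuclideanSpace ℝ (Fin d) → ℂ) ⊤ volume :=
  memLp_top_indicator_closedBall (by fun_prop) r

/-- The derivative of the truncated symbol in `σ`. -/
def truncSymbolDeriv (k : ℕ) (r σ : ℝ) (ξ : EuclideanSpace ℝ (Fin d)) : ℂ :=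
  Complex.I * (lapSymbol ξ : ℂ) * truncSymbol k r σ ξ

theorem memLp_truncSymbolDeriv (k : ℕ) (r σ : ℝ) :
    MemLp (truncSymbolDeriv k r σ : EuclideanSpace ℝ (Fin d) → ℂ) ⊤ volume := by
  have h := memLp_top_indicator_closedBall (d := d) (g := fun ξ => Complex.I * (lapSymbol ξ : ℂ) *
    ((weight k ξ : ℂ) * Complex.exp (Complex.I * ((σ * lapSymbol ξ : ℝ) : ℂ)))) (by fun_prop) r
  convert h using 1
  ext ξ
  by_cases hξ : ξ ∈ Metric.closedBall (0 : EuclideanSpace ℝ (Fin d)) r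
  · simp only [truncSymbolDeriv, truncSymbol, Set.indicator_of_mem hξ]
  · simp only [truncSymbolDeriv, truncSymbol, Set.indicator_of_notMem hξ, mul_zero]

theorem norm_Lp_top_le_of_ae_bound {α : Type*} [MeasurableSpace α] {μ : Measure α} {f : Lp ℂ ⊤ μ}
    {C : ℝ} (hC : 0 ≤ C) (h : ∀ᵐ x ∂μ, ‖f x‖ ≤ C) : ‖f‖ ≤ C := by
  rw [Lp.norm_def, eLpNorm_exponent_top]
  exact ENNReal.toReal_le_of_le_ofReal hC (eLpNormEssSup_le_of_ae_bound h)

/-- Because of the cut-off, the symbol depends differentiably on `σ` in the uniform norm. -/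
theorem hasDerivAt_toLp_truncSymbol (k : ℕ) (r σ : ℝ) :
    HasDerivAt (fun σ => (memLp_truncSymbol (d := d) k r σ).toLp _)
      ((memLp_truncSymbolDeriv k r σ).toLp _) σ := by
  obtain ⟨W, hW⟩ := (isCompact_closedBall (0 : EuclideanSpace ℝ (Fin d))
    r).exists_bound_of_continuousOn (continuous_weight k).continuousOn
  obtain ⟨m, hm⟩ := (isCompact_closedBall (0 : EuclideanSpace ℝ (Fin d))
    r).exists_bound_of_continuousOn continuous_lapSymbol.continuousOn
  have bound : ∀ h : ℝ, |h| * |m| ≤ 1 →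
      ‖(memLp_truncSymbol (d := d) k r (σ + h)).toLp _ - (memLp_truncSymbol k r σ).toLp _ -
        h • (memLp_truncSymbolDeriv k r σ).toLp _‖ ≤ |W| * m ^ 2 * h ^ 2 := by
    intro h hh
    refine norm_Lp_top_le_of_ae_bound (by positivity) ?_
    filter_upwards [Lp.coeFn_sub ((memLp_truncSymbol (d := d) k r (σ + h)).toLp _ -
          (memLp_truncSymbol k r σ).toLp _) (h • (memLp_truncSymbolDeriv k r σ).toLp _),
      Lp.coeFn_sub ((memLp_truncSymbol (d := d) k r (σ + h)).toLp _)
        ((memLp_truncSymbol k r σ).toLp _),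
      Lp.coeFn_smul h ((memLp_truncSymbolDeriv (d := d) k r σ).toLp _),
      (memLp_truncSymbol (d := d) k r (σ + h)).coeFn_toLp,
      (memLp_truncSymbol (d := d) k r σ).coeFn_toLp,
      (memLp_truncSymbolDeriv (d := d) k r σ).coeFn_toLp] with ξ h1 h2 h3 h4 h5 h6
    rw [h1, Pi.sub_apply, h2, Pi.sub_apply, h3, Pi.smul_apply, h4, h5, h6]
    by_cases hξ : ξ ∈ Metric.closedBall (0 : EuclideanSpace ℝ (Fin d)) r
    · have hz : ‖Complex.I * ((h * lapSymbol ξ : ℝ) : ℂ)‖ = |h| * |lapSymbol ξ| := by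
        rw [norm_mul, Complex.norm_I, one_mul, Complex.norm_real, Real.norm_eq_abs, abs_mul]
      have hmξ : |lapSymbol ξ| ≤ |m| := (hm ξ hξ).trans (le_abs_self m)
      have hz1 : ‖Complex.I * ((h * lapSymbol ξ : ℝ) : ℂ)‖ ≤ 1 := by
        rw [hz]
        exact (mul_le_mul_of_nonneg_left hmξ (abs_nonneg h)).trans hh
      have e : truncSymbol k r (σ + h) ξ - truncSymbol k r σ ξ -
          h • truncSymbolDeriv k r σ ξ = (weight k ξ : ℂ) *
            Complex.exp (Complex.I * ((σ * lapSymbol ξ : ℝ) : ℂ)) *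
            (Complex.exp (Complex.I * ((h * lapSymbol ξ : ℝ) : ℂ)) - 1 -
              Complex.I * ((h * lapSymbol ξ : ℝ) : ℂ)) := by
        have ee : Complex.exp (Complex.I * (((σ + h) * lapSymbol ξ : ℝ) : ℂ)) =
            Complex.exp (Complex.I * ((σ * lapSymbol ξ : ℝ) : ℂ)) *
              Complex.exp (Complex.I * ((h * lapSymbol ξ : ℝ) : ℂ)) := by
          rw [← Complex.exp_add]
          congr 1
          push_cast
          ring
        simp only [truncSymbolDeriv, truncSymbol, Set.indicator_of_mem hξ, ee, Complex.real_smul]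
        push_cast
        ring
      rw [e, norm_mul, norm_mul, Complex.norm_exp_I_mul_ofReal, mul_one, Complex.norm_real]
      calc ‖weight k ξ‖ * _ ≤ |W| * (|h| * |m|) ^ 2 := by
            gcongr
            · exact (hW ξ hξ).trans (le_abs_self W)
            · refine (Complex.norm_exp_sub_one_sub_id_le hz1).trans ?_
              rw [hz]
              gcongr
        _ = |W| * m ^ 2 * h ^ 2 := by rw [mul_pow, sq_abs, sq_abs]; ring
    · simp only [truncSymbolDeriv, truncSymbol, Set.indicator_of_notMem hξ, mul_zero, smul_zero,
        sub_zero, norm_zero]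
      positivity
  rw [hasDerivAt_iff_isLittleO_nhds_zero]
  refine Asymptotics.IsBigO.trans_isLittleO (g := fun h : ℝ => h ^ 2) ?_ ?_
  · refine Asymptotics.IsBigO.of_bound (|W| * m ^ 2) ?_
    have hnear : ∀ᶠ h : ℝ in nhds 0, |h| * |m| < 1 := by
      refine ContinuousAt.eventually_lt (f := fun h : ℝ => |h| * |m|) (g := fun _ => 1)
        (by fun_prop) (by fun_prop) (by simp)
    filter_upwards [hnear] with h hh
    rw [Real.norm_of_nonneg (sq_nonneg h)]
    exact bound h hh.le
  · exact Asymptotics.isLittleO_pow_id one_lt_two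

/-- Multiplication of `L²` functions by the truncated symbol. -/
def truncMul (k : ℕ) (r σ : ℝ) : L2 d →L[ℂ] L2 d :=
  (ContinuousLinearMap.mul ℂ ℂ).holderL volume ⊤ 2 2 ((memLp_truncSymbol k r σ).toLp _)

/-- The derivative of `truncMul` in `σ`. -/
def truncMulDeriv (k : ℕ) (r σ : ℝ) : L2 d →L[ℂ] L2 d :=
  (ContinuousLinearMap.mul ℂ ℂ).holderL volume ⊤ 2 2 ((memLp_truncSymbolDeriv k r σ).toLp _)

theorem truncMul_ae_eq (k : ℕ) (r σ : ℝ) (f : L2 d) :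
    truncMul k r σ f =ᵐ[volume] fun ξ => truncSymbol k r σ ξ * f ξ := by
  filter_upwards [(ContinuousLinearMap.mul ℂ ℂ).coeFn_holder (r := 2)
    ((memLp_truncSymbol k r σ).toLp _) f, (memLp_truncSymbol k r σ).coeFn_toLp] with ξ h1 h2
  rw [ContinuousLinearMap.mul_apply', h2] at h1
  exact h1

theorem truncMulDeriv_ae_eq (k : ℕ) (r σ : ℝ) (f : L2 d) :
    truncMulDeriv k r σ f =ᵐ[volume]
      fun ξ => Complex.I * (lapSymbol ξ : ℂ) * truncSymbol k r σ ξ * f ξ := by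
  filter_upwards [(ContinuousLinearMap.mul ℂ ℂ).coeFn_holder (r := 2)
    ((memLp_truncSymbolDeriv k r σ).toLp _) f, (memLp_truncSymbolDeriv k r σ).coeFn_toLp]
    with ξ h1 h2
  rw [ContinuousLinearMap.mul_apply', h2] at h1
  exact h1

theorem hasDerivAt_truncMul (k : ℕ) (r σ : ℝ) :
    HasDerivAt (fun σ => (truncMul k r σ : L2 d →L[ℂ] L2 d).restrictScalars ℝ)
      ((truncMulDeriv k r σ).restrictScalars ℝ) σ :=
  ((ContinuousLinearMap.restrictScalarsL ℂ (L2 d) (L2 d) ℝ ℝ).comp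
    (((ContinuousLinearMap.mul ℂ ℂ).holderL volume ⊤ 2 2).restrictScalars
      ℝ)).hasFDerivAt.comp_hasDerivAt σ (hasDerivAt_toLp_truncSymbol k r σ)

theorem truncMul_fourier_ae_eq (k : ℕ) (r σ : ℝ) (f : L2 d) :
    truncMul k r σ (𝓕 f) =ᵐ[volume] (Metric.closedBall 0 r).indicator
      fun ξ => (weight k ξ : ℂ) * (𝓕 (freeFlow (-σ) f) : L2 d) ξ := by
  filter_upwards [truncMul_ae_eq k r σ (𝓕 f), fourier_freeFlow_ae_eq (-σ) f] with ξ h1 h2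
  rw [h1, truncSymbol]
  by_cases hξ : ξ ∈ Metric.closedBall (0 : EuclideanSpace ℝ (Fin d)) r
  · rw [Set.indicator_of_mem hξ, Set.indicator_of_mem hξ, h2, lapSymbol, neg_mul, neg_neg,
      mul_assoc]
  · rw [Set.indicator_of_notMem hξ, Set.indicator_of_notMem hξ, zero_mul]

theorem enorm_truncMul_fourier (k : ℕ) (r σ : ℝ) (f : L2 d) :
    ‖truncMul k r σ (𝓕 f)‖ₑ = eLpNorm ((Metric.closedBall 0 r).indicator
      fun ξ => (weight k ξ : ℂ) * (𝓕 (freeFlow (-σ) f) : L2 d) ξ) 2 volume := by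
  rw [Lp.enorm_def]
  exact eLpNorm_congr_ae (truncMul_fourier_ae_eq k r σ f)

theorem enorm_truncMul_fourier_le (k : ℕ) (r σ : ℝ) (f : L2 d) :
    ‖truncMul k r σ (𝓕 f)‖ₑ ≤ sobolevNorm k f := by
  rw [enorm_truncMul_fourier, ← sobolevNorm_freeFlow k (-σ) f]
  exact eLpNorm_indicator_le _

/-- The cut-off can be removed. -/
theorem sobolevNorm_le_of_forall_truncMul (k : ℕ) {f : L2 d} {C : ℝ≥0∞}
    (h : ∀ r : ℕ, ‖truncMul k r 0 (𝓕 f)‖ₑ ≤ C) : sobolevNorm k f ≤ C := by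
  have hmeas := aestronglyMeasurable_weight_mul k (𝓕 f : L2 d)
  refine (Lp.eLpNorm_lim_le_liminf_eLpNorm (f := fun r : ℕ =>
    (Metric.closedBall (0 : EuclideanSpace ℝ (Fin d)) (r : ℝ)).indicator
      fun ξ => (weight k ξ : ℂ) * (𝓕 f : L2 d) ξ)
    (fun r => hmeas.indicator Metric.isClosed_closedBall.measurableSet) _
    (Filter.Eventually.of_forall fun ξ => ?_)).trans ?_
  · refine tendsto_const_nhds.congr' ?_
    filter_upwards [Filter.eventually_ge_atTop ⌈‖ξ‖⌉₊] with r hr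
    exact (Set.indicator_of_mem (mem_closedBall_zero_iff.2 (Nat.ceil_le.1 hr))
      fun ξ => (weight k ξ : ℂ) * (𝓕 f : L2 d) ξ).symm
  · refine Filter.liminf_le_of_le (by isBoundedDefault) fun b hb => ?_
    obtain ⟨r, hr⟩ := hb.exists
    refine hr.trans ?_
    have := h r
    rwa [enorm_truncMul_fourier, neg_zero, freeFlow_zero] at this

/-- If `∂ₜψ = iΔψ + n`, then `∂ₜ(e^{-i(t-a)Δ}ψ) = e^{-i(t-a)Δ}n`. This is an estimate in `H^k`
although the time derivatives exist in `L²` only: the mean value inequality is applied to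
frequency-truncated functions, and the cut-off is removed afterwards. -/
theorem sobolevNorm_interaction_le (k : ℕ) {a b B : ℝ} (hab : a ≤ b) {ψ ψ' n : ℝ → L2 d}
    {κ : L2 d} (hB : 0 ≤ B)
    (hd : ∀ t ∈ Set.Icc a b, HasDerivWithinAt ψ (ψ' t) (Set.Icc a b) t)
    (hF : ∀ t ∈ Set.Icc a b, (𝓕 (ψ' t) : L2 d) =ᵐ[volume]
      fun ξ => -(Complex.I * (lapSymbol ξ : ℂ)) * (𝓕 (ψ t) : L2 d) ξ + (𝓕 (n t) : L2 d) ξ)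
    (hn : ∀ t ∈ Set.Icc a b, sobolevNorm k (freeFlow (-(t - a)) (n t) - κ) ≤ ENNReal.ofReal B) :
    sobolevNorm k (freeFlow (-(b - a)) (ψ b) - ψ a - ((b - a : ℝ) : ℂ) • κ) ≤
      ENNReal.ofReal (B * (b - a)) := by
  refine sobolevNorm_le_of_forall_truncMul k fun r => ?_
  have key := norm_image_sub_le_of_norm_deriv_le_segment' (a := a) (b := b) (C := B)
    (f := fun t => truncMul k r (t - a) (𝓕 (ψ t) : L2 d) - (t - a) • truncMul k r 0 (𝓕 κ : L2 d))
    (f' := fun t => truncMulDeriv k r (t - a) (𝓕 (ψ t) : L2 d) +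
      truncMul k r (t - a) (𝓕 (ψ' t) : L2 d) - (1 : ℝ) • truncMul k r 0 (𝓕 κ : L2 d)) ?_ ?_ b
      (Set.right_mem_Icc.2 hab)
  · have e : truncMul k r 0 (𝓕 (freeFlow (-(b - a)) (ψ b) - ψ a - ((b - a : ℝ) : ℂ) • κ) : L2 d) =
        truncMul k r (b - a) (𝓕 (ψ b) : L2 d) - (b - a) • truncMul k r 0 (𝓕 κ : L2 d) -
        (truncMul k r (a - a) (𝓕 (ψ a) : L2 d) - (a - a) • truncMul k r 0 (𝓕 κ : L2 d)) := by
      have h1 : truncMul k r 0 (𝓕 (freeFlow (-(b - a)) (ψ b)) : L2 d) =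
          truncMul k r (b - a) (𝓕 (ψ b)) := by
        refine Lp.ext ((truncMul_fourier_ae_eq k r 0 _).trans ?_)
        rw [neg_zero, freeFlow_zero]
        exact (truncMul_fourier_ae_eq k r (b - a) _).symm
      rw [L2.fourier_sub, L2.fourier_sub, FourierTransform.fourier_smul, map_sub, map_sub, h1,
        map_smul, sub_self, zero_smul, sub_zero, Complex.coe_smul]
      abel
    rw [e, ← ofReal_norm]
    exact ENNReal.ofReal_le_ofReal key
  · intro t ht
    have h1 : HasDerivWithinAt (fun t => (𝓕 (ψ t) : L2 d)) (𝓕 (ψ' t) : L2 d) (Set.Icc a b) t :=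
      (((Lp.fourierTransformₗᵢ _ ℂ).toContinuousLinearEquiv.toContinuousLinearMap.restrictScalars
        ℝ).hasFDerivAt.comp_hasDerivWithinAt t (hd t ht))
    have h2 : HasDerivWithinAt
        (fun t => (truncMul k r (t - a) : L2 d →L[ℂ] L2 d).restrictScalars ℝ)
        ((truncMulDeriv k r (t - a)).restrictScalars ℝ) (Set.Icc a b) t :=
      ((hasDerivAt_truncMul k r (t - a)).comp_sub_const t a).hasDerivWithinAt
    have h3 : HasDerivWithinAt (fun t => (t - a) • truncMul k r 0 (𝓕 κ : L2 d))
        ((1 : ℝ) • truncMul k r 0 (𝓕 κ : L2 d)) (Set.Icc a b) t :=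
      (((hasDerivAt_id t).sub_const a).hasDerivWithinAt).smul_const _
    exact (h2.clm_apply h1).sub h3
  · intro t ht
    have ht' := Set.Ico_subset_Icc_self ht
    have e : truncMulDeriv k r (t - a) (𝓕 (ψ t) : L2 d) + truncMul k r (t - a) (𝓕 (ψ' t) : L2 d) -
        (1 : ℝ) • truncMul k r 0 (𝓕 κ : L2 d) =
        truncMul k r 0 (𝓕 (freeFlow (-(t - a)) (n t) - κ) : L2 d) := by
      have h1 : truncMulDeriv k r (t - a) (𝓕 (ψ t) : L2 d) +
          truncMul k r (t - a) (𝓕 (ψ' t) : L2 d) = truncMul k r (t - a) (𝓕 (n t)) := by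
        refine Lp.ext ?_
        filter_upwards [Lp.coeFn_add (truncMulDeriv k r (t - a) (𝓕 (ψ t) : L2 d))
            (truncMul k r (t - a) (𝓕 (ψ' t) : L2 d)),
          truncMulDeriv_ae_eq k r (t - a) (𝓕 (ψ t) : L2 d),
          truncMul_ae_eq k r (t - a) (𝓕 (ψ' t) : L2 d),
          truncMul_ae_eq k r (t - a) (𝓕 (n t) : L2 d), hF t ht'] with ξ g1 g2 g3 g4 g5
        rw [g1, Pi.add_apply, g2, g3, g4, g5]
        ring
      have h2 : truncMul k r 0 (𝓕 (freeFlow (-(t - a)) (n t)) : L2 d) =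
          truncMul k r (t - a) (𝓕 (n t)) := by
        refine Lp.ext ((truncMul_fourier_ae_eq k r 0 _).trans ?_)
        rw [neg_zero, freeFlow_zero]
        exact (truncMul_fourier_ae_eq k r (t - a) _).symm
      rw [h1, L2.fourier_sub, map_sub, h2, one_smul]
    rw [e, ← ENNReal.ofReal_le_ofReal_iff hB, ofReal_norm]
    exact (enorm_truncMul_fourier_le k r 0 _).trans (hn t ht')

/-- The Fourier transform of the distributional Laplacian, if the latter is square integrable. -/
theorem fourier_lap_ae_eq {f lap : L2 d}
    (h : (lap : 𝓢'(EuclideanSpace ℝ (Fin d), ℂ)) = Δ (f : 𝓢'(EuclideanSpace ℝ (Fin d), ℂ))) :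
    (𝓕 lap : L2 d) =ᵐ[volume] fun ξ => -(lapSymbol ξ : ℂ) * (𝓕 f : L2 d) ξ := by
  have hl : LocallyIntegrable (fun ξ => -(lapSymbol ξ : ℂ) * (𝓕 f : L2 d) ξ) volume := by
    have h0 : LocallyIntegrable (𝓕 f : L2 d) volume :=
      (Lp.memLp _).locallyIntegrable (by norm_num)
    exact h0.continuous_smul (g := fun ξ => -(lapSymbol ξ : ℂ)) (by fun_prop)
  refine ae_eq_of_integral_contDiff_smul_eq
    ((Lp.memLp _).locallyIntegrable (by norm_num)) hl fun g hg hgc => ?_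
  have hg₁ : HasCompactSupport (Complex.ofRealCLM ∘ g) := hgc.comp_left rfl
  have hg₂ : ContDiff ℝ (⊤ : ℕ∞) (Complex.ofRealCLM ∘ g) := by fun_prop
  let φ : 𝓢(EuclideanSpace ℝ (Fin d), ℂ) := hg₁.toSchwartzMap hg₂
  have hφ : ∀ x, φ x = (g x : ℂ) := fun x => rfl
  have htg : (fun x : EuclideanSpace ℝ (Fin d) => Complex.ofReal (‖x‖ ^ 2)).HasTemperateGrowth := by
    fun_prop
  have h2 : Lp.toTemperedDistribution (𝓕 lap : L2 d) = (-(2 * Real.pi) ^ 2 : ℝ) •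
      TemperedDistribution.smulLeftCLM ℂ (fun x : EuclideanSpace ℝ (Fin d) =>
        Complex.ofReal (‖x‖ ^ 2)) (Lp.toTemperedDistribution (𝓕 f : L2 d)) := by
    rw [← Lp.fourier_toTemperedDistribution_eq, h,
      TemperedDistribution.laplacian_eq_fourierMultiplierCLM,
      TemperedDistribution.fourierMultiplierCLM_apply, ← Complex.coe_smul,
      FourierTransform.fourier_smul, FourierTransform.fourier_fourierInv_eq,
      Lp.fourier_toTemperedDistribution_eq, Complex.coe_smul]
  have h3 := congrArg (fun u => u φ) h2
  calc ∫ x, g x • (𝓕 lap : L2 d) x = Lp.toTemperedDistribution (𝓕 lap : L2 d) φ := by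
        rw [Lp.toTemperedDistribution_apply]
        simp [hφ]
    _ = (-(2 * Real.pi) ^ 2 : ℝ) • TemperedDistribution.smulLeftCLM ℂ
        (fun x : EuclideanSpace ℝ (Fin d) => Complex.ofReal (‖x‖ ^ 2))
        (Lp.toTemperedDistribution (𝓕 f : L2 d)) φ := h3
    _ = (-(2 * Real.pi) ^ 2 : ℝ) • ∫ x, (((‖x‖ ^ 2 : ℝ) : ℂ) • φ x) • (𝓕 f : L2 d) x := by
        rw [TemperedDistribution.smulLeftCLM_apply_apply, Lp.toTemperedDistribution_apply]
        simp only [SchwartzMap.smulLeftCLM_apply_apply htg]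
    _ = _ := by
        rw [← integral_smul]
        congr 1
        ext x
        simp only [hφ, lapSymbol, smul_eq_mul, Complex.real_smul]
        push_cast
        ring

end ExactFlow


/-! ### The local error -/

section LocalError

variable {d : ℕ}

/-- The equation on the Fourier side, with the cubic term as a source. -/
theorem IsSolution.exists_source {μ T : ℝ} {ψ₀ : L2 d} {ψ : ℝ → L2 d}
    (h : IsSolution μ T ψ₀ ψ) : ∃ ψ' cub : ℝ → L2 d, ∀ t ∈ Set.Icc 0 T,
      HasDerivWithinAt ψ (ψ' t) (Set.Icc 0 T) t ∧
      (cub t =ᵐ[volume] fun x => ((‖ψ t x‖ ^ 2 : ℝ) : ℂ) * ψ t x) ∧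
      (𝓕 (ψ' t) : L2 d) =ᵐ[volume] fun ξ => -(Complex.I * (lapSymbol ξ : ℂ)) * (𝓕 (ψ t) : L2 d) ξ +
        (𝓕 ((-(Complex.I * (μ : ℂ))) • cub t) : L2 d) ξ := by
  have h' : ∀ t, ∃ ψ' cub : L2 d, t ∈ Set.Icc 0 T →
      HasDerivWithinAt ψ ψ' (Set.Icc 0 T) t ∧
      (cub =ᵐ[volume] fun x => ((‖ψ t x‖ ^ 2 : ℝ) : ℂ) * ψ t x) ∧
      (𝓕 ψ' : L2 d) =ᵐ[volume] fun ξ => -(Complex.I * (lapSymbol ξ : ℂ)) * (𝓕 (ψ t) : L2 d) ξ +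
        (𝓕 ((-(Complex.I * (μ : ℂ))) • cub) : L2 d) ξ := by
    intro t
    by_cases ht : t ∈ Set.Icc 0 T
    · obtain ⟨ψ', lap, cub, h1, h2, h3, h4⟩ := h.equation t ht
      refine ⟨ψ', cub, fun _ => ⟨h1, h3, ?_⟩⟩
      have e : ψ' = Complex.I • lap + (-(Complex.I * (μ : ℂ))) • cub := by
        have h5 := congrArg (fun f : L2 d => (-Complex.I) • f) h4
        simp only [smul_smul, smul_add, smul_neg, neg_mul, Complex.I_mul_I, neg_neg, one_smul,
          neg_smul] at h5
        rw [h5, neg_smul]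
      have e2 : (𝓕 ψ' : L2 d) = Complex.I • (𝓕 lap : L2 d) +
          𝓕 ((-(Complex.I * (μ : ℂ))) • cub) := by
        rw [e, FourierTransform.fourier_add, FourierTransform.fourier_smul]
      rw [e2]
      filter_upwards [Lp.coeFn_add (Complex.I • (𝓕 lap : L2 d))
          (𝓕 ((-(Complex.I * (μ : ℂ))) • cub)), Lp.coeFn_smul Complex.I (𝓕 lap : L2 d),
          fourier_lap_ae_eq h2] with ξ g1 g2 g3
      rw [g1, Pi.add_apply, g2, Pi.smul_apply, g3, smul_eq_mul]
      ring
    · exact ⟨0, 0, fun ht' => absurd ht' ht⟩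
  choose ψ' cub h'' using h'
  exact ⟨ψ', cub, fun t ht => h'' t ht⟩

theorem sobolevNorm_add_le_ofReal {k : ℕ} {f g : L2 d} {A B : ℝ} (hA : 0 ≤ A) (hB : 0 ≤ B)
    (hf : sobolevNorm k f ≤ ENNReal.ofReal A) (hg : sobolevNorm k g ≤ ENNReal.ofReal B) :
    sobolevNorm k (f + g) ≤ ENNReal.ofReal (A + B) := by
  rw [ENNReal.ofReal_add hA hB]
  exact (sobolevNorm_add_le k f g).trans (add_le_add hf hg)

theorem sobolevNorm_source (k : ℕ) (μ : ℝ) (f : L2 d) :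
    sobolevNorm k ((-(Complex.I * (μ : ℂ))) • f) = ENNReal.ofReal |μ| * sobolevNorm k f := by
  rw [sobolevNorm_smul, ← ofReal_norm, norm_neg, norm_mul, Complex.norm_I, one_mul,
    Complex.norm_real, Real.norm_eq_abs]

/-- One step of the splitting scheme, started on the exact solution, has an error `O(τ²)` in `H^s`
if the solution is bounded in `H^{s+2}`. -/
theorem exists_local_error_le {s : ℕ} (hs : (d : ℝ) < 2 * s) (μ : ℝ) {T M : ℝ}
    (hM : 0 ≤ M) : ∃ C : ℝ, 0 ≤ C ∧ ∀ (ψ₀ : L2 d) (ψ : ℝ → L2 d), IsSolution μ T ψ₀ ψ →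
      (∀ t ∈ Set.Icc 0 T, sobolevNorm (s + 2) (ψ t) ≤ ENNReal.ofReal M) →
      ∀ a τ : ℝ, 0 ≤ a → 0 ≤ τ → a + τ ≤ T →
        sobolevNorm s (freeFlow τ (nonlinearFlow μ τ (ψ a)) - ψ (a + τ)) ≤
          ENNReal.ofReal (C * τ ^ 2) := by
  have hs2 : (d : ℝ) < 2 * (s + 2 : ℕ) := by push_cast; linarith
  obtain ⟨C₁, hC₁, h₁⟩ := exists_sobolevNorm_cubic_le hs hM
  obtain ⟨C₂, hC₂, h₂⟩ := exists_sobolevNorm_cubic_le hs2 hM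
  obtain ⟨C₃, hC₃, h₃⟩ := exists_sobolevNorm_cubic_sub_le hs hM
  obtain ⟨C₄, hC₄, h₄⟩ := exists_sobolevNorm_nonlinearFlow_taylor_le hs μ (T := T) hM
  set L := |μ| * C₁ + M with hL
  have hL0 : 0 ≤ L := by positivity
  set D := |μ| * (C₃ * L) + |μ| * C₂ with hD
  have hD0 : 0 ≤ D := by positivity
  refine ⟨C₄ + D, by positivity, fun ψ₀ ψ hψ hbd a τ ha hτ haτ => ?_⟩
  have hbd' : ∀ t ∈ Set.Icc 0 T, sobolevNorm s (ψ t) ≤ ENNReal.ofReal M := fun t ht =>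
    (sobolevNorm_mono (by omega) _).trans (hbd t ht)
  obtain ⟨ψ', cub, hsrc⟩ := hψ.exists_source
  set n : ℝ → L2 d := fun t => (-(Complex.I * (μ : ℂ))) • cub t with hn
  have hsub : Set.Icc a (a + τ) ⊆ Set.Icc 0 T := Set.Icc_subset_Icc ha haτ
  have ha' : a ∈ Set.Icc a (a + τ) := Set.left_mem_Icc.2 (by linarith)
  -- the solution is Lipschitz continuous in time with values in `H^s`
  have lip : ∀ t ∈ Set.Icc a (a + τ),
      sobolevNorm s (ψ t - ψ a) ≤ ENNReal.ofReal (L * (t - a)) := by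
    intro t ht
    have hta : 0 ≤ t - a := by linarith [ht.1]
    have hsub' : Set.Icc a t ⊆ Set.Icc 0 T := (Set.Icc_subset_Icc_right ht.2).trans hsub
    have h := sobolevNorm_interaction_le s ht.1 (ψ := ψ) (ψ' := ψ') (n := n) (κ := 0)
      (B := |μ| * C₁) (by positivity) (fun r hr => ((hsrc r (hsub' hr)).1).mono hsub')
      (fun r hr => (hsrc r (hsub' hr)).2.2) (fun r hr => by
        rw [sub_zero, sobolevNorm_freeFlow, sobolevNorm_source,
          ENNReal.ofReal_mul (abs_nonneg μ)]
        gcongr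
        exact h₁ _ _ (hbd' r (hsub' hr)) (hsrc r (hsub' hr)).2.1)
    rw [smul_zero, sub_zero] at h
    have h' : sobolevNorm s (ψ t - freeFlow (-(t - a)) (ψ t)) ≤ ENNReal.ofReal (M * (t - a)) := by
      rw [sobolevNorm_sub_comm]
      refine (sobolevNorm_freeFlow_sub_le s _ _).trans ?_
      rw [abs_neg, abs_of_nonneg hta, mul_comm M, ENNReal.ofReal_mul hta]
      gcongr
      exact hbd t (hsub ht)
    have e : ψ t - ψ a = (freeFlow (-(t - a)) (ψ t) - ψ a) + (ψ t - freeFlow (-(t - a)) (ψ t)) := by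
      abel
    rw [e, hL, add_mul]
    exact sobolevNorm_add_le_ofReal (by positivity) (by positivity) h h'
  have main := sobolevNorm_interaction_le s (by linarith : a ≤ a + τ) (ψ := ψ) (ψ' := ψ') (n := n)
    (κ := n a) (B := D * τ) (by positivity) (fun r hr => ((hsrc r (hsub hr)).1).mono hsub)
    (fun r hr => (hsrc r (hsub hr)).2.2) (fun r hr => by
      have hra : 0 ≤ r - a := by linarith [hr.1]
      have hrτ : r - a ≤ τ := by linarith [hr.2]
      have e : freeFlow (-(r - a)) (n r) - n a =
          freeFlow (-(r - a)) (n r - n a) + (freeFlow (-(r - a)) (n a) - n a) := by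
        rw [freeFlow_sub]
        abel
      rw [e, hD, add_mul]
      refine sobolevNorm_add_le_ofReal (by positivity) (by positivity) ?_ ?_
      · rw [sobolevNorm_freeFlow, hn, ← smul_sub, sobolevNorm_source, mul_assoc,
          ENNReal.ofReal_mul (abs_nonneg μ)]
        gcongr
        refine (h₃ _ _ _ _ (hbd' r (hsub hr)) (hbd' a (hsub ha')) (hsrc r (hsub hr)).2.1
          (hsrc a (hsub ha')).2.1).trans ?_
        rw [mul_assoc, ENNReal.ofReal_mul hC₃]
        gcongr
        refine (lip r hr).trans (ENNReal.ofReal_le_ofReal ?_)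
        gcongr
      · refine (sobolevNorm_freeFlow_sub_le s _ _).trans ?_
        rw [abs_neg, abs_of_nonneg hra, hn, sobolevNorm_source, mul_comm _ τ,
          ENNReal.ofReal_mul hτ, ENNReal.ofReal_mul (abs_nonneg μ)]
        gcongr
        exact h₂ _ _ (hbd a (hsub ha')) (hsrc a (hsub ha')).2.1)
  rw [add_sub_cancel_left] at main
  have taylor := h₄ τ hτ (by linarith) (ψ a) (cub a) (hbd' a (hsub ha')) (hsrc a (hsub ha')).2.1
  have e : freeFlow τ (nonlinearFlow μ τ (ψ a)) - ψ (a + τ) =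
      freeFlow τ (nonlinearFlow μ τ (ψ a) - freeFlow (-τ) (ψ (a + τ))) := by
    have h := freeFlow_neg_freeFlow (-τ) (ψ (a + τ))
    rw [neg_neg] at h
    rw [freeFlow_sub, h]
  have e2 : nonlinearFlow μ τ (ψ a) - freeFlow (-τ) (ψ (a + τ)) =
      (nonlinearFlow μ τ (ψ a) - ψ a + (Complex.I * ((τ * μ : ℝ) : ℂ)) • cub a) +
        -(freeFlow (-τ) (ψ (a + τ)) - ψ a - ((τ : ℝ) : ℂ) • n a) := by
    have : ((τ : ℝ) : ℂ) • n a = -((Complex.I * ((τ * μ : ℝ) : ℂ)) • cub a) := by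
      rw [hn, smul_smul, ← neg_smul]
      congr 1
      push_cast
      ring
    rw [this]
    abel
  rw [e, sobolevNorm_freeFlow, e2, add_mul]
  refine sobolevNorm_add_le_ofReal (by positivity) (by positivity) taylor ?_
  rw [sobolevNorm_neg]
  refine main.trans (le_of_eq ?_)
  congr 1
  ring

end LocalError

/-! ### Convergence -/

section Convergence

variable {d : ℕ}

theorem nonlinearFlow_zero (μ τ : ℝ) : nonlinearFlow μ τ (0 : L2 d) = 0 := by
  refine Lp.ext ?_
  filter_upwards [nonlinearFlow_ae_eq μ τ (0 : L2 d), Lp.coeFn_zero ℂ 2 volume] with x h1 h2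
  rw [h1, h2, Pi.zero_apply, mul_zero]

/-- For a fixed number of steps the splitting scheme is bounded in `H^s`, uniformly in the time
step. -/
theorem exists_sobolevNorm_lieSplitting_le {s : ℕ} (hs : (d : ℝ) < 2 * s) (μ : ℝ) {T M : ℝ}
    (hT : 0 ≤ T) (hM : 0 ≤ M) (n : ℕ) : ∃ B : ℝ, 0 ≤ B ∧ ∀ (ψ₀ : L2 d) (τ : ℝ), 0 ≤ τ → τ ≤ T →
      sobolevNorm s ψ₀ ≤ ENNReal.ofReal M →
        sobolevNorm s (lieSplitting μ τ ψ₀ n) ≤ ENNReal.ofReal B := by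
  induction n with
  | zero => exact ⟨M, hM, fun ψ₀ τ _ _ h => h⟩
  | succ n ih =>
    obtain ⟨B, hB, hb⟩ := ih
    obtain ⟨C, hC, hc⟩ := exists_sobolevNorm_nonlinearFlow_sub_le hs μ hT hB
    refine ⟨(1 + C * T) * B, by positivity, fun ψ₀ τ h0 h1 h2 => ?_⟩
    have h3 := hb ψ₀ τ h0 h1 h2
    have h4 := hc τ h0 h1 (lieSplitting μ τ ψ₀ n) 0 h3 (by rw [sobolevNorm_zero]; exact zero_le)
    rw [nonlinearFlow_zero, sub_zero, sub_zero] at h4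
    rw [lieSplitting, sobolevNorm_freeFlow]
    refine h4.trans ?_
    rw [ENNReal.ofReal_mul (by positivity)]
    gcongr

/-- First-order convergence in `H^s`, `s > d/2`, for solutions that are bounded in `H^{s+2}`. -/
theorem exists_sobolevNorm_error_le {s : ℕ} (hs : (d : ℝ) < 2 * s) (μ : ℝ) {T M : ℝ}
    (hT : 0 < T) (hM : 0 ≤ M) : ∃ C : ℝ, 0 < C ∧ ∀ (ψ₀ : L2 d) (ψ : ℝ → L2 d),
      IsSolution μ T ψ₀ ψ →
      (∀ t ∈ Set.Icc 0 T, sobolevNorm (s + 2) (ψ t) ≤ ENNReal.ofReal M) →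
      ∀ τ : ℝ, 0 < τ → ∀ n : ℕ, (n : ℝ) * τ ≤ T →
        sobolevNorm s (lieSplitting μ τ ψ₀ n - ψ ((n : ℝ) * τ)) ≤ ENNReal.ofReal (C * τ) := by
  obtain ⟨C₁, hC₁, loc⟩ := exists_local_error_le hs μ (T := T) hM
  have hM1 : 0 ≤ M + 1 := by linarith
  obtain ⟨C₂, hC₂, stab⟩ := exists_sobolevNorm_nonlinearFlow_sub_le hs μ hT.le hM1
  choose B hB hb using exists_sobolevNorm_lieSplitting_le hs μ hT.le hM
  set E := C₁ * T * Real.exp (C₂ * T) + 1 with hE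
  have hE1 : 1 ≤ E := by
    have : 0 ≤ C₁ * T * Real.exp (C₂ * T) := by positivity
    linarith
  have hE0 : 0 < E := by linarith
  set S := ∑ i ∈ Finset.range (⌈T * E⌉₊ + 1), B i with hS
  have hS0 : 0 ≤ S := Finset.sum_nonneg fun i _ => hB i
  refine ⟨E + (S + M) * E, by positivity, fun ψ₀ ψ hψ hbd τ hτ n hn => ?_⟩
  have hbd' : ∀ t ∈ Set.Icc 0 T, sobolevNorm s (ψ t) ≤ ENNReal.ofReal M := fun t ht =>
    (sobolevNorm_mono (by omega) _).trans (hbd t ht)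
  have h0T : (0 : ℝ) ∈ Set.Icc 0 T := ⟨le_rfl, hT.le⟩
  have hψ₀ : sobolevNorm s ψ₀ ≤ ENNReal.ofReal M := by
    rw [← hψ.initial]
    exact hbd' 0 h0T
  rcases le_or_gt (E * τ) 1 with hsmall | hlarge
  · -- Small time steps: as long as the error is at most `1`, the scheme remains in the ball of
    -- radius `M + 1`, on which the stability estimate holds.
    have hind : ∀ n : ℕ, (n : ℝ) * τ ≤ T → sobolevNorm s (lieSplitting μ τ ψ₀ n - ψ ((n : ℝ) * τ)) ≤
        ENNReal.ofReal (n * C₁ * τ ^ 2 * Real.exp (C₂ * (n * τ))) := by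
      intro n
      induction n with
      | zero =>
        intro _
        simp [lieSplitting, hψ.initial, sobolevNorm_zero]
      | succ n ih =>
        intro hn1
        have hcast : ((n + 1 : ℕ) : ℝ) * τ = n * τ + τ := by push_cast; ring
        rw [hcast] at hn1 ⊢
        have hnτ : (0 : ℝ) ≤ n * τ := by positivity
        have hnT : (n : ℝ) * τ ≤ T := by linarith
        have hmem : (n : ℝ) * τ ∈ Set.Icc 0 T := ⟨hnτ, hnT⟩
        have ih' := ih hnT
        have hle1 : n * C₁ * τ ^ 2 * Real.exp (C₂ * (n * τ)) ≤ 1 := by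
          calc n * C₁ * τ ^ 2 * Real.exp (C₂ * (n * τ))
              = C₁ * (n * τ) * Real.exp (C₂ * (n * τ)) * τ := by ring
            _ ≤ C₁ * T * Real.exp (C₂ * T) * τ := by gcongr
            _ ≤ E * τ := by gcongr; linarith
            _ ≤ 1 := hsmall
        have hball : sobolevNorm s (lieSplitting μ τ ψ₀ n) ≤ ENNReal.ofReal (M + 1) := by
          have e : lieSplitting μ τ ψ₀ n =
              ψ (n * τ) + (lieSplitting μ τ ψ₀ n - ψ (n * τ)) := by abel
          rw [e]
          exact sobolevNorm_add_le_ofReal hM zero_le_one (hbd' _ hmem)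
            (ih'.trans (ENNReal.ofReal_le_ofReal hle1))
        have hst := stab τ hτ.le (by linarith) _ _ hball
          ((hbd' _ hmem).trans (ENNReal.ofReal_le_ofReal (by linarith : M ≤ M + 1)))
        have hlo := loc ψ₀ ψ hψ hbd (n * τ) τ hnτ hτ.le hn1
        have e : lieSplitting μ τ ψ₀ (n + 1) - ψ (n * τ + τ) =
            freeFlow τ (nonlinearFlow μ τ (lieSplitting μ τ ψ₀ n) - nonlinearFlow μ τ (ψ (n * τ))) +
              (freeFlow τ (nonlinearFlow μ τ (ψ (n * τ))) - ψ (n * τ + τ)) := by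
          rw [freeFlow_sub, lieSplitting]
          abel
        have hfirst : sobolevNorm s (freeFlow τ (nonlinearFlow μ τ (lieSplitting μ τ ψ₀ n) -
            nonlinearFlow μ τ (ψ (n * τ)))) ≤
              ENNReal.ofReal ((1 + C₂ * τ) * (n * C₁ * τ ^ 2 * Real.exp (C₂ * (n * τ)))) := by
          rw [sobolevNorm_freeFlow, ENNReal.ofReal_mul (by positivity)]
          exact hst.trans (by gcongr)
        rw [e]
        refine (sobolevNorm_add_le_ofReal (by positivity) (by positivity) hfirst hlo).trans
          (ENNReal.ofReal_le_ofReal ?_)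
        have hexp : 1 + C₂ * τ ≤ Real.exp (C₂ * τ) := by
          linarith [Real.add_one_le_exp (C₂ * τ)]
        have hone : 1 ≤ Real.exp (C₂ * (n * τ + τ)) := Real.one_le_exp (by positivity)
        calc (1 + C₂ * τ) * (n * C₁ * τ ^ 2 * Real.exp (C₂ * (n * τ))) + C₁ * τ ^ 2
            ≤ Real.exp (C₂ * τ) * (n * C₁ * τ ^ 2 * Real.exp (C₂ * (n * τ))) +
                C₁ * τ ^ 2 * Real.exp (C₂ * (n * τ + τ)) :=
              add_le_add (by gcongr) (le_mul_of_one_le_right (by positivity) hone)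
          _ = _ := by
              rw [mul_add C₂, Real.exp_add]
              push_cast
              ring
    refine (hind n hn).trans (ENNReal.ofReal_le_ofReal ?_)
    calc n * C₁ * τ ^ 2 * Real.exp (C₂ * (n * τ))
        = C₁ * (n * τ) * Real.exp (C₂ * (n * τ)) * τ := by ring
      _ ≤ C₁ * T * Real.exp (C₂ * T) * τ := by gcongr
      _ ≤ (E + (S + M) * E) * τ := by
          gcongr
          have : 0 ≤ (S + M) * E := by positivity
          linarith
  · -- Large time steps: the number of steps is at most `T E`.
    rcases Nat.eq_zero_or_pos n with rfl | hpos
    · simp [lieSplitting, hψ.initial, sobolevNorm_zero]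
    have hn1 : (1 : ℝ) ≤ n := by exact_mod_cast hpos
    have hτT : τ ≤ T := by nlinarith
    have hmem : (n : ℝ) * τ ∈ Set.Icc 0 T := ⟨by positivity, hn⟩
    have hnE : (n : ℝ) ≤ T * E := by
      calc (n : ℝ) ≤ n * (E * τ) := le_mul_of_one_le_right (by positivity) hlarge.le
        _ = n * τ * E := by ring
        _ ≤ T * E := by gcongr
    have hnr : n ∈ Finset.range (⌈T * E⌉₊ + 1) := by
      rw [Finset.mem_range, Nat.lt_succ_iff]
      exact_mod_cast hnE.trans (Nat.le_ceil _)
    have hBS : B n ≤ S := Finset.single_le_sum (f := B) (fun i _ => hB i) hnr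
    rw [sub_eq_add_neg]
    refine (sobolevNorm_add_le_ofReal hS0 hM ((hb n ψ₀ τ hτ.le hτT hψ₀).trans
      (ENNReal.ofReal_le_ofReal hBS)) ((sobolevNorm_neg s _).trans_le (hbd' _ hmem))).trans
      (ENNReal.ofReal_le_ofReal ?_)
    calc S + M ≤ (S + M) * (E * τ) := le_mul_of_one_le_right (by positivity) hlarge.le
      _ ≤ E * τ + (S + M) * (E * τ) := le_add_of_nonneg_left (by positivity)
      _ = (E + (S + M) * E) * τ := by ring

theorem sobolevNorm_le_of_supSigmaNorm_le {k : ℕ} {T : ℝ} {M : ℝ≥0} {ψ : ℝ → L2 d}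
    (h : supSigmaNorm k T ψ ≤ M) :
    ∀ t ∈ Set.Icc 0 T, sobolevNorm k (ψ t) ≤ ENNReal.ofReal M := by
  intro t ht
  rw [ENNReal.ofReal_coe_nnreal]
  have h1 : sobolevNorm k (ψ t) ≤ sigmaNorm k (ψ t) := le_self_add
  exact (h1.trans (le_iSup₂ (f := fun t (_ : t ∈ Set.Icc 0 T) => sigmaNorm k (ψ t)) t ht)).trans h

/-- For given `k` there are finitely many dimensions `d < 2(k - 2)`, and one constant serves for
all of them. -/
theorem exists_uniform_error_le (μ T : ℝ) (hT : 0 < T) (k : ℕ) (M : ℝ≥0) :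
    ∃ C : ℝ, 0 < C ∧ ∀ d : ℕ, (d : ℝ) / 2 + 2 < k → ∀ (ψ₀ : L2 d) (ψ : ℝ → L2 d),
      IsSolution μ T ψ₀ ψ → supSigmaNorm k T ψ ≤ M → ∀ τ : ℝ, 0 < τ → ∀ n : ℕ, (n : ℝ) * τ ≤ T →
        sobolevNorm (k - 2) (lieSplitting μ τ ψ₀ n - ψ ((n : ℝ) * τ)) ≤ ENNReal.ofReal (C * τ) := by
  have h : ∀ d : ℕ, ∃ C : ℝ, 0 < C ∧ ((d : ℝ) / 2 + 2 < k → ∀ (ψ₀ : L2 d) (ψ : ℝ → L2 d),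
      IsSolution μ T ψ₀ ψ → supSigmaNorm k T ψ ≤ M → ∀ τ : ℝ, 0 < τ → ∀ n : ℕ, (n : ℝ) * τ ≤ T →
        sobolevNorm (k - 2) (lieSplitting μ τ ψ₀ n - ψ ((n : ℝ) * τ)) ≤
          ENNReal.ofReal (C * τ)) := by
    intro d
    by_cases hd : (d : ℝ) / 2 + 2 < k
    · have hd0 : (0 : ℝ) ≤ d := Nat.cast_nonneg d
      have hk : 2 ≤ k := by
        have : (2 : ℝ) ≤ k := by linarith
        exact_mod_cast this
      obtain ⟨s, rfl⟩ := Nat.exists_eq_add_of_le' hk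
      have hs : (d : ℝ) < 2 * s := by push_cast at hd; linarith
      obtain ⟨C, hC, h⟩ := exists_sobolevNorm_error_le hs μ hT M.2
      exact ⟨C, hC, fun _ ψ₀ ψ hψ hM =>
        h ψ₀ ψ hψ (sobolevNorm_le_of_supSigmaNorm_le hM)⟩
    · exact ⟨1, one_pos, fun hd' => absurd hd' hd⟩
  choose C hC hmain using h
  have hpos : 0 < ∑ d ∈ Finset.range (2 * k + 1), C d :=
    Finset.sum_pos (fun d _ => hC d) ⟨0, by simp⟩
  refine ⟨_, hpos, fun d hd ψ₀ ψ hψ hM τ hτ n hn => (hmain d hd ψ₀ ψ hψ hM τ hτ n hn).trans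
    (ENNReal.ofReal_le_ofReal ?_)⟩
  gcongr
  refine Finset.single_le_sum (f := C) (fun i _ => (hC i).le) ?_
  have : (d : ℝ) < 2 * k + 1 := by linarith
  rw [Finset.mem_range]
  exact_mod_cast this

end Convergence

end LieNLS

end

theorem mainTheorem3 (μ : ℝ) (hμ : μ ≠ 0) (T : ℝ) (hT : 0 < T) (k : ℕ) (M : ℝ≥0) :
    (∃ C : ℝ, 0 < C ∧ ∀ d : ℕ, 0 < d → (d : ℝ) / 2 + 2 < k →
      ∀ (ψ₀ : LieNLS.L2 d) (ψ : ℝ → LieNLS.L2 d), LieNLS.IsSolution μ T ψ₀ ψ →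
        LieNLS.supSigmaNorm k T ψ ≤ M →
        ∀ τ : ℝ, 0 < τ → ∀ n : ℕ, (n : ℝ) * τ ≤ T →
          ‖LieNLS.lieSplitting μ τ ψ₀ n - ψ ((n : ℝ) * τ)‖ ≤ C * τ) ∧
    (∃ C : ℝ, 0 < C ∧ ∀ d : ℕ, 0 < d → max ((d : ℝ) / 2 + 2) 3 < k →
      ∀ (ψ₀ : LieNLS.L2 d) (ψ : ℝ → LieNLS.L2 d), LieNLS.IsSolution μ T ψ₀ ψ →
        LieNLS.supSigmaNorm k T ψ ≤ M →
        ∀ τ : ℝ, 0 < τ → ∀ n : ℕ, (n : ℝ) * τ ≤ T →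
          LieNLS.sobolevNorm 1 (LieNLS.lieSplitting μ τ ψ₀ n - ψ ((n : ℝ) * τ)) ≤
            ENNReal.ofReal (C * τ)) := by
  obtain ⟨C, hC, h⟩ := LieNLS.exists_uniform_error_le μ T hT k M
  refine ⟨⟨C, hC, fun d _ hd ψ₀ ψ hψ hM τ hτ n hn => ?_⟩,
    ⟨C, hC, fun d _ hd ψ₀ ψ hψ hM τ hτ n hn => ?_⟩⟩
  · rw [← ENNReal.ofReal_le_ofReal_iff (by positivity), ofReal_norm]
    exact (LieNLS.enorm_le_sobolevNorm _ _).trans (h d hd ψ₀ ψ hψ hM τ hτ n hn)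
  · have hk : 1 ≤ k - 2 := by
      have h3 : (3 : ℝ) < k := (le_max_right _ _).trans_lt hd
      have h3' : 3 < k := by exact_mod_cast h3
      omega
    exact (LieNLS.sobolevNorm_mono hk _).trans
      (h d ((le_max_left _ _).trans_lt hd) ψ₀ ψ hψ hM τ hτ n hn)
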